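/- **Setting.** Let $G$ be an undirected, unweighted graph without self-loops on $n$ nodes, with adjacency matrix $A$ and node features $X\in\mathbb R^{n\times p}$. Write $A=U\,\mathrm{diag}(\Lambda)\,U^T$, where $\Lambda\in\mathbb R^r$ lists the non-zero eigenvalues of $A$ with multiplicity and $U\in\mathbb R^{n\times r}$ has corresponding orthonormal eigenvectors as columns. A *Point Set Transformer (PST)* of hidden dimension $d$ consists of a continuous permutation-equivariant eigenvalue function $f:\mathbb R^r\to\mathbb R^{r\times d}$ (for every $r$), a linear embedding of node features, and a finite list of layers. Node $i$ has a scalar representation $s_i\in\mathbb R^d$, initialised with the embedding of $X_i$, and a vector representation $v_i\in\mathbb R^{r\times d}$, initialised with the coordinates whose $c$-th channel is the $i$-th row of $U\,\mathrm{diag}(f_c(\Lambda))$. A layer computes $$s_i'=\mathrm{MLP}_1\big(s_i\,\|\,\mathrm{diagonal}(W_1v_i^Tv_iW_2^T)\big),\qquad v_i'=v_i\,\mathrm{diag}(\mathrm{MLP}_2(s_i))\,W_3+v_iW_4,$$ $$\mathrm{Atten}_{ij}=\mathrm{MLP}_3\big((W_q^ss_i\odot W_k^ss_j)\,\|\,\mathrm{diagonal}(W_q^vv_i^Tv_jW_k^v)\big)\quad\text{(with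 finitely many heads)},$$ and then updates $$s_i\leftarrow\mathrm{MLP}_4\big(s_i'\,\|\,\textstyle\sum_j\mathrm{Atten}_{ij}s_j'\big),\qquad v_i\leftarrow \big(v_i'\,\|\,\textstyle\sum_j\mathrm{Atten}_{ij}v_j'\big)W_5^T,$$ where $\|$ is concatenation (over all heads, for the sums), the MLPs are ReLU multilayer perceptrons and the $W$'s are real matrices. For $L\ge 3$ let $C_L(G,i)$ be the number of cycles of length $L$ in $G$ that pass through node $i$, two cycles being identified if they have the same set of edges. A PST *counts cycles of length $L$* on graphs with at most $N$ nodes if the last-layer scalar representation of a node expresses this number: there is a function $\varphi:\mathbb R^d\to\mathbb R$ such that, for every graph $G$ with at most $N$ nodes, all node features $X$, every choice of $(\Lambda,U)$ as above and every node $i$, one has $\varphi(s_i)=C_L(G,i)$. **Theorem.** For every $p$ and every $N$: * there is a one-layer PST that counts cycles of length $3$ on graphs with at most $N$ nodes; * there is a three-layer PST that counts both cycles of length $4$ and cycles of length $5$ on graphs with at most $N$ nodes; * there is a five-layer PST that counts both cycles of length $6$ and cycles of length $7$ on graphs with at most $N$ nodes. -/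

import Mathlib

open Matrix

/-! ### Multilayer perceptrons -/

/-- A multilayer perceptron with ReLU activations, whose inputs are indexed by `ι` and whose outputs
are indexed by `κ`: any number of hidden layers of any widths, and an affine output layer. -/
inductive MLP (κ : Type) : Type → Type 1 where
  | output {ι : Type} (W : Matrix κ ι ℝ) (b : κ → ℝ) : MLP κ ι
  | hidden {ι : Type} {w : ℕ} (W : Matrix (Fin w) ι ℝ) (b : Fin w → ℝ) (next : MLP κ (Fin w)) :
      MLP κ ι

/-- The function computed by a multilayer perceptron. -/
noncomputable def MLP.eval {κ : Type} : {ι : Type} → [Fintype ι] → MLP κ ι → (ι → ℝ) → (κ → ℝ)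
  | _, _, .output W b, x => W *ᵥ x + b
  | _, _, .hidden W b next, x => next.eval fun a => max ((W *ᵥ x + b) a) 0

/-! ### Point-set coordinates of a graph -/

/-- `IsReducedEigendecomposition A Λ U`: the entries of `Λ` are the non-zero eigenvalues of the
symmetric matrix `A`, with multiplicity, and the columns of `U` are corresponding orthonormal
eigenvectors. -/
structure IsReducedEigendecomposition {n r : ℕ} (A : Matrix (Fin n) (Fin n) ℝ) (Λ : Fin r → ℝ)
    (U : Matrix (Fin n) (Fin r) ℝ) : Prop where
  ne_zero : ∀ a, Λ a ≠ 0
  orthonormal : Uᵀ * U = 1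
  eq_mul : A = U * Matrix.diagonal Λ * Uᵀ

/-- Every real symmetric matrix has a reduced eigendecomposition. -/
theorem exists_isReducedEigendecomposition {n : ℕ} (A : Matrix (Fin n) (Fin n) ℝ)
    (hA : A.IsSymm) :
    ∃ (r : ℕ) (Λ : Fin r → ℝ) (U : Matrix (Fin n) (Fin r) ℝ),
      IsReducedEigendecomposition A Λ U := by
  have hH : A.IsHermitian := by
    rw [Matrix.IsHermitian, Matrix.conjTranspose_eq_transpose_of_trivial]
    exact hA
  let e := (Fintype.equivFin {i // hH.eigenvalues i ≠ 0}).symm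
  have hspec := hH.spectral_theorem
  have hUU : (hH.eigenvectorUnitary : Matrix (Fin n) (Fin n) ℝ)ᵀ *
      (hH.eigenvectorUnitary : Matrix (Fin n) (Fin n) ℝ) = 1 := by
    have h := Unitary.coe_star_mul_self hH.eigenvectorUnitary
    rwa [Matrix.star_eq_conjTranspose, Matrix.conjTranspose_eq_transpose_of_trivial] at h
  refine ⟨_, fun a => hH.eigenvalues (e a).1,
    Matrix.of fun i a => (hH.eigenvectorUnitary : Matrix (Fin n) (Fin n) ℝ) i (e a).1,
    fun a => (e a).2, ?_, ?_⟩
  · ext a b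
    have h := congrFun (congrFun hUU (e a).1) (e b).1
    rw [Matrix.mul_apply] at h ⊢
    simp only [Matrix.transpose_apply, Matrix.of_apply] at h ⊢
    rw [h, Matrix.one_apply, Matrix.one_apply]
    simp [Subtype.val_inj]
  · ext i j
    have h := congrFun (congrFun hspec i) j
    rw [h, Unitary.conjStarAlgAut_apply, Matrix.star_eq_conjTranspose,
      Matrix.conjTranspose_eq_transpose_of_trivial, Matrix.mul_apply, Matrix.mul_apply]
    simp only [Matrix.mul_diagonal, Matrix.transpose_apply, Function.comp_apply,
      RCLike.ofReal_real_eq_id, id_eq, Matrix.of_apply]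
    rw [e.sum_comp (fun x : {i // hH.eigenvalues i ≠ 0} =>
      (hH.eigenvectorUnitary : Matrix (Fin n) (Fin n) ℝ) i x.1 * hH.eigenvalues x.1 *
        (hH.eigenvectorUnitary : Matrix (Fin n) (Fin n) ℝ) j x.1)]
    rw [← Finset.sum_filter_of_ne (p := fun k => hH.eigenvalues k ≠ 0)]
    · exact Finset.sum_subtype _ (by simp) _
    · intro k _ hk h0
      exact hk (by rw [h0]; ring)

/-- A `d`-channel eigenvalue function: for every `r`, a continuous permutation-equivariant map
`ℝ^r → ℝ^(r × d)`. -/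
structure EigenvalueFunction (d : ℕ) where
  toFun : (r : ℕ) → (Fin r → ℝ) → Fin r → Fin d → ℝ
  continuous : ∀ r, Continuous (toFun r)
  equivariant : ∀ (r : ℕ) (σ : Equiv.Perm (Fin r)) (Λ : Fin r → ℝ),
    toFun r (Λ ∘ σ) = toFun r Λ ∘ σ

/-- The coordinates of the nodes that an eigenvalue function `f` makes of an eigendecomposition
`(Λ, U)`; channel `c` is `U diag(f_c(Λ))`, so node `i` has the coordinate matrix
`(psrd f Λ U i) a c = U i a * f_c(Λ) a`. -/
def psrd {n r d : ℕ} (f : EigenvalueFunction d) (Λ : Fin r → ℝ) (U : Matrix (Fin n) (Fin r) ℝ)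
    (i : Fin n) : Matrix (Fin r) (Fin d) ℝ :=
  fun a c => (U * Matrix.diagonal fun b => f.toFun r Λ b c) i a

/-! ### The point set transformer -/

/-- Point representations of `n` nodes with coordinate rank `r` and hidden dimension `d`:
for every node a scalar representation `s i ∈ ℝ^d` and a vector representation
`v i ∈ ℝ^(r × d)`. -/
structure PointRep (n r d : ℕ) where
  s : Fin n → Fin d → ℝ
  v : Fin n → Matrix (Fin r) (Fin d) ℝ

/-- The parameters of one layer of hidden dimension `d`: those of the scalar-vector mixer, those of
the (multi-head) attention matrix, and those of the output maps. -/
structure PSTLayer (d : ℕ) where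
  heads : ℕ
  mlp₁ : MLP (Fin d) (Fin d ⊕ Fin d)
  W₁ : Matrix (Fin d) (Fin d) ℝ
  W₂ : Matrix (Fin d) (Fin d) ℝ
  mlp₂ : MLP (Fin d) (Fin d)
  W₃ : Matrix (Fin d) (Fin d) ℝ
  W₄ : Matrix (Fin d) (Fin d) ℝ
  Wqs : Matrix (Fin d) (Fin d) ℝ
  Wks : Matrix (Fin d) (Fin d) ℝ
  Wqv : Matrix (Fin d) (Fin d) ℝ
  Wkv : Matrix (Fin d) (Fin d) ℝ
  mlp₃ : MLP (Fin heads) (Fin d ⊕ Fin d)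
  mlp₄ : MLP (Fin d) (Fin d ⊕ (Fin heads × Fin d))
  W₅ : Matrix (Fin d) (Fin d ⊕ (Fin heads × Fin d)) ℝ

namespace PSTLayer

variable {n r d : ℕ}

/-- Scalar-vector mixer, scalar part: `s_i' = MLP₁(s_i ‖ diagonal(W₁ v_iᵀ v_i W₂ᵀ))`. -/
noncomputable def mixS (P : PSTLayer d) (x : PointRep n r d) (i : Fin n) : Fin d → ℝ :=
  P.mlp₁.eval (Sum.elim (x.s i) (P.W₁ * (x.v i)ᵀ * x.v i * P.W₂ᵀ).diag)

/-- Scalar-vector mixer, vector part: `v_i' = v_i diag(MLP₂(s_i)) W₃ + v_i W₄`. -/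
noncomputable def mixV (P : PSTLayer d) (x : PointRep n r d) (i : Fin n) :
    Matrix (Fin r) (Fin d) ℝ :=
  x.v i * Matrix.diagonal (P.mlp₂.eval (x.s i)) * P.W₃ + x.v i * P.W₄

/-- The entries of the attention matrices at `(i, j)`, one for each head:
`MLP₃((Wqs s_i ⊙ Wks s_j) ‖ diagonal(Wqv v_iᵀ v_j Wkv))`. -/
noncomputable def atten (P : PSTLayer d) (x : PointRep n r d) (i j : Fin n) : Fin P.heads → ℝ :=
  P.mlp₃.eval (Sum.elim (fun c => (P.Wqs *ᵥ x.s i) c * (P.Wks *ᵥ x.s j) c)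
    (P.Wqv * (x.v i)ᵀ * x.v j * P.Wkv).diag)

/-- One layer of the transformer. The mixed representation of a point and, for every head, the
attention-weighted sum of the mixed representations of all points are concatenated and sent through
an output map, a multilayer perceptron for scalars and a linear map of channels for vectors:
`s_i ← MLP₄(s_i' ‖ ∑_j Atten_ij s_j')`, `v_i ← (v_i' ‖ ∑_j Atten_ij v_j') W₅ᵀ`. -/
noncomputable def apply (P : PSTLayer d) (x : PointRep n r d) : PointRep n r d where
  s i := P.mlp₄.eval
    (Sum.elim (P.mixS x i) fun hc => ∑ j, P.atten x i j hc.1 * P.mixS x j hc.2)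
  v i := Matrix.fromCols (P.mixV x i)
    (Matrix.of fun a hc => ∑ j, P.atten x i j hc.1 * P.mixV x j a hc.2) * P.W₅ᵀ

end PSTLayer

/-- A point set transformer of hidden dimension `d` for graphs with `p` node features: an eigenvalue
function for the coordinates, a linear embedding of the node features, and a list of layers. -/
structure PST (p d : ℕ) where
  coord : EigenvalueFunction d
  embed : Matrix (Fin d) (Fin p) ℝ
  layers : List (PSTLayer d)

namespace PST

variable {p d : ℕ}

/-- The number of layers. -/
def numLayers (P : PST p d) : ℕ := P.layers.length

/-- The point representations after the last layer, on a graph with node features `X` whose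
adjacency matrix has the eigendecomposition `(Λ, U)`. -/
noncomputable def rep {n r : ℕ} (P : PST p d) (Λ : Fin r → ℝ) (U : Matrix (Fin n) (Fin r) ℝ)
    (X : Matrix (Fin n) (Fin p) ℝ) : PointRep n r d :=
  P.layers.foldl (fun x L => L.apply x)
    { s := fun i => P.embed *ᵥ X i, v := psrd P.coord Λ U }

end PST

/-! ### Counting cycles -/

/-- The number of cycles of length `L` that pass through the node `u`; cycles with the same set of
edges are identified. -/
noncomputable def cycleCount {V : Type} (G : SimpleGraph V) (L : ℕ) (u : V) : ℕ :=
  Set.ncard {E : Set (Sym2 V) | ∃ (w : V) (c : G.Walk w w),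
    c.IsCycle ∧ c.length = L ∧ u ∈ c.support ∧ E = {e | e ∈ c.edges}}

/-- `P` counts the cycles of length `L` at the nodes of the graphs with at most `N` nodes: on all
these graphs, with any node features, and for all choices of eigenvectors, the last scalar
representation of a node expresses the number of cycles of length `L` through the node, that is, the
number is a fixed function `φ` of the representation. -/
def PST.CountsCycles {p d : ℕ} (P : PST p d) (N L : ℕ) : Prop :=
  ∃ φ : (Fin d → ℝ) → ℝ, ∀ (n : ℕ), n ≤ N →
    ∀ (G : SimpleGraph (Fin n)) [DecidableRel G.Adj] (X : Matrix (Fin n) (Fin p) ℝ)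
      (r : ℕ) (Λ : Fin r → ℝ) (U : Matrix (Fin n) (Fin r) ℝ),
      IsReducedEigendecomposition (G.adjMatrix ℝ) Λ U →
        ∀ i : Fin n, φ ((P.rep Λ U X).s i) = (cycleCount G L i : ℝ)

/-! There are only finitely many graphs with at most N nodes, so each MLP meets finitely many inputs
and can compute any function of them (`MLP.exists_eval_eq`). Hence one universal transformer serves
all cases. Its vector channels are U diag(Λ)^k for k ≤ 7 and M U for the attention matrices M of the
previous layer. The inner products it reads are entries of A^k and M A^k with k ≥ 1, so nothing
depends on the chosen eigenvectors (`Stage.sum_chan_mul_chan`). Its attention heads are the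
indicators of the classes of pairs of nodes with equal information (`Stage.exists_layer`).

Consequently the pair functions determined after t layers (`PairDet t`) contain A^k for 1 ≤ k ≤ 7
and are closed under entrywise products and transposition. One further layer gives their products
with A^k (`PairDet.mul_pow`) and their row sums as node functions (`PairDet.sum`).

On the combinatorial side, twice the number of L-cycles through i is the number of injective closed
walks of length L from i (`walksExactly_bot`). Inclusion-exclusion over the partitions of the L
positions (`nodeDet_walksExactly`) reduces this to closed walks with prescribed coincidences, that
is, homomorphisms from a quotient of the L-cycle that send the root to i. Such a number is a sum of
products of entries of A, and its variables can be eliminated one at a time: a variable with one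
neighbour leaves a row sum, one with two neighbours a matrix product, and parallel edges merge into
an entrywise product. Keeping account of the layers spent, a finite search evaluated by the kernel
(`checkPatterns`) shows that every quotient can be eliminated within 1 layer for L = 3, 3 layers for
L = 4, 5 and 5 layers for L = 6, 7. -/

/-! ### Interpolation by ReLU networks -/

/-- Piecewise linear interpolation on a finite set of reals. -/
theorem exists_sum_relu_eq {κ : Type} (s : Finset ℝ) (g : ℝ → κ → ℝ) :
    ∃ (w : ℕ) (b : Fin w → ℝ) (α : Fin w → κ → ℝ) (c : κ → ℝ),
      ∀ x ∈ s, ∀ k, ∑ a, α a k * max (x - b a) 0 + c k = g x k := by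
  induction s using Finset.induction_on_max with
  | empty => exact ⟨0, Fin.elim0, Fin.elim0, 0, by simp⟩
  | insert y s hy ih =>
    obtain ⟨w, b, α, c, h⟩ := ih
    rcases s.eq_empty_or_nonempty with rfl | hs
    · exact ⟨0, Fin.elim0, Fin.elim0, g y, by simp⟩
    · set z := s.max' hs
      have hz : z < y := hy z (s.max'_mem hs)
      -- The new knot is the previous maximum `z`, so the new ReLU vanishes at all older points; its
      -- slope corrects the value at `y`.
      refine ⟨w + 1, Fin.snoc b z, Fin.snoc α fun k =>
        (g y k - (∑ a, α a k * max (y - b a) 0 + c k)) / (y - z), c, ?_⟩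
      intro x hx k
      simp only [Fin.sum_univ_castSucc, Fin.snoc_castSucc, Fin.snoc_last]
      rcases Finset.mem_insert.1 hx with rfl | hx
      · have : x - z ≠ 0 := by linarith
        rw [max_eq_left (by linarith : (0 : ℝ) ≤ x - z)]
        field_simp
        ring
      · have hxz : x ≤ z := s.le_max' x hx
        rw [max_eq_right (by linarith : x - z ≤ 0), ← h x hx k]
        ring

/-- A multilayer perceptron interpolates every function on a finite family of inputs. -/
theorem MLP.exists_eval_eq {ι κ T : Type} [Fintype ι] [Finite T] (Z : T → ι → ℝ) (Y : T → κ → ℝ)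
    (h : ∀ u u', Z u = Z u' → Y u = Y u') : ∃ m : MLP κ ι, ∀ u, m.eval (Z u) = Y u := by
  classical
  -- A linear functional that kills none of the finitely many non-zero differences separates the
  -- inputs and leaves a one-variable problem.
  obtain ⟨D, hD⟩ := Module.exists_dual_forall_apply_ne_zero (K := ℝ)
    (fun q : {q : T × T // Z q.1 ≠ Z q.2} => Z q.1.1 - Z q.1.2) (fun q => sub_ne_zero.2 q.2)
  have hinj : ∀ u u', D (Z u) = D (Z u') → Z u = Z u' := by
    intro u u' e
    by_contra hne
    exact hD ⟨(u, u'), hne⟩ (by rw [map_sub, e, sub_self])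
  have hf : ∀ u u', D (Z u) = D (Z u') → Y u = Y u' := fun u u' e => h u u' (hinj u u' e)
  cases nonempty_fintype T
  obtain ⟨w, b, α, c, hs⟩ := exists_sum_relu_eq (Finset.univ.image fun u => D (Z u))
    (Function.extend (fun u => D (Z u)) Y 0)
  have hDsum : ∀ z : ι → ℝ, D z = ∑ a, D (Pi.single a 1) * z a := by
    intro z
    conv_lhs => rw [← Finset.univ_sum_single z]
    rw [map_sum]
    refine Finset.sum_congr rfl fun a _ => ?_
    have : Pi.single a (z a) = z a • (Pi.single a 1 : ι → ℝ) := by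
      rw [← Pi.single_smul, smul_eq_mul, mul_one]
    rw [this, map_smul, smul_eq_mul, mul_comm]
  refine ⟨.hidden (Matrix.of fun _ a => D (Pi.single a 1)) (fun a => -b a)
    (.output (Matrix.of fun k a => α a k) c), fun u => ?_⟩
  funext k
  have h1 := hs (D (Z u)) (Finset.mem_image_of_mem _ (Finset.mem_univ u)) k
  rw [Function.FactorsThrough.extend_apply (fun u u' e => hf u u' e)] at h1
  rw [← h1]
  simp only [MLP.eval, Matrix.mulVec, dotProduct, Matrix.of_apply, Pi.add_apply, ← hDsum,
    ← sub_eq_add_neg]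

/-! ### Graphs with a bounded number of nodes -/

/-- The graphs with at most `N` nodes. -/
abbrev BddGraph (N : ℕ) : Type := Σ n : Fin (N + 1), SimpleGraph (Fin n)

/-- The graphs with at most `N` nodes, with a distinguished node. -/
abbrev BddNode (N : ℕ) : Type := Σ g : BddGraph N, Fin g.1

/-- The graphs with at most `N` nodes, with a distinguished pair of nodes. -/
abbrev BddPair (N : ℕ) : Type := Σ g : BddGraph N, Fin g.1 × Fin g.1

/-- Real functions of the nodes of graphs. -/
abbrev NodeFun (N : ℕ) : Type := ∀ g : BddGraph N, Fin g.1 → ℝ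

/-- Real functions of the pairs of nodes of graphs. -/
abbrev PairFun (N : ℕ) : Type := ∀ g : BddGraph N, Matrix (Fin g.1) (Fin g.1) ℝ

variable {N : ℕ}

open Classical in
/-- The adjacency matrix. -/
noncomputable def adjMat (g : BddGraph N) : Matrix (Fin g.1) (Fin g.1) ℝ := g.2.adjMatrix ℝ

theorem adjMat_isSymm (g : BddGraph N) : (adjMat g).IsSymm := by
  classical
  exact g.2.isSymm_adjMatrix

theorem IsReducedEigendecomposition.pow_succ {n r : ℕ} {A : Matrix (Fin n) (Fin n) ℝ}
    {Λ : Fin r → ℝ} {U : Matrix (Fin n) (Fin r) ℝ} (h : IsReducedEigendecomposition A Λ U) (k : ℕ) :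
    A ^ (k + 1) = U * Matrix.diagonal (fun a => Λ a ^ (k + 1)) * Uᵀ := by
  induction k with
  | zero => simpa using h.eq_mul
  | succ k ih =>
    rw [_root_.pow_succ, ih]
    conv_lhs => rw [h.eq_mul]
    have : U * diagonal (fun a => Λ a ^ (k + 1)) * Uᵀ * (U * diagonal Λ * Uᵀ) =
        U * diagonal (fun a => Λ a ^ (k + 1)) * (Uᵀ * U) * diagonal Λ * Uᵀ := by
      simp only [Matrix.mul_assoc]
    rw [this, h.orthonormal, Matrix.mul_one, Matrix.mul_assoc U, Matrix.diagonal_mul_diagonal]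
    simp only [_root_.pow_succ]

theorem exists_code {T α : Type*} [Finite T] (f : T → α) :
    ∃ c : T → ℝ, ∀ u u', c u = c u' ↔ f u = f u' := by
  obtain ⟨m, ⟨e⟩⟩ := Finite.exists_equiv_fin (Set.range f)
  refine ⟨fun u => ((e ⟨f u, u, rfl⟩ : ℕ) : ℝ), fun u u' => ⟨fun h => ?_, fun h => by simp only [h]⟩⟩
  exact congrArg Subtype.val (e.injective (Fin.ext (Nat.cast_injective h)))

/-- Real numbers that tell the values of a function on a finite type apart. -/
noncomputable def code {T α : Type*} [Finite T] (f : T → α) : T → ℝ := (exists_code f).choose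

theorem code_eq_iff {T α : Type*} [Finite T] (f : T → α) (u u' : T) :
    code f u = code f u' ↔ f u = f u' := (exists_code f).choose_spec u u'

/-! ### The channels of a universal transformer -/

/-- What the representations after some layer know: a colour of every node, and a family of
matrices by which the coordinates are multiplied. -/
structure Stage (N : ℕ) where
  col : NodeFun N
  mult : BddPair N → PairFun N

/-- Vector channels: `U diag(Λ) ^ k` for `k ≤ 7`, and `M U` for the matrices `M` of the stage. -/
abbrev Chan (N : ℕ) : Type := Fin 8 ⊕ BddPair N

/-- The inner products of vector channels that the attention uses. -/
abbrev Readout (N : ℕ) : Type := Fin 7 ⊕ (BddPair N × Fin 7) ⊕ (BddPair N × Fin 7)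

namespace Readout

/-- The third block is the second with the two nodes exchanged, which makes the information on pairs
closed under transposition. Every readout involves one channel with a positive power of Λ. -/
def left : Readout N → Chan N
  | .inl _ => .inl 0
  | .inr (.inl (h, _)) => .inr h
  | .inr (.inr (_, k)) => .inl k.succ

def right : Readout N → Chan N
  | .inl k => .inl k.succ
  | .inr (.inl (_, k)) => .inl k.succ
  | .inr (.inr (h, _)) => .inr h

end Readout

/-- The channels of the universal transformer: a constant and the colour, the vector channels, and
room for the readouts. -/
abbrev Slot (N : ℕ) : Type := Bool ⊕ Chan N ⊕ Readout N

/-- The hidden dimension of the universal transformer. -/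
abbrev hidDim (N : ℕ) : ℕ := Fintype.card (Slot N)

/-- The channels in some order. -/
noncomputable def slot (N : ℕ) : Fin (hidDim N) ≃ Slot N := (Fintype.equivFin (Slot N)).symm

namespace Stage

variable (S : Stage N)

/-- The values of the readouts. -/
noncomputable def read (g : BddGraph N) (i j : Fin g.1) : Readout N → ℝ
  | .inl k => (adjMat g ^ ((k : ℕ) + 1)) i j
  | .inr (.inl (h, k)) => (S.mult h g * adjMat g ^ ((k : ℕ) + 1)) i j
  | .inr (.inr (h, k)) => (S.mult h g * adjMat g ^ ((k : ℕ) + 1)) j i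

/-- All that the attention knows of a pair of nodes. -/
noncomputable def info (g : BddGraph N) (i j : Fin g.1) : ℝ × ℝ × (Readout N → ℝ) :=
  (S.col g i, S.col g j, S.read g i j)

open Classical in
/-- The stage after the next layer, whose attention heads are the indicators of the classes of pairs
of nodes that the present stage tells apart. -/
noncomputable def next : Stage N where
  mult h g i j := if S.info g i j = S.info h.1 h.2.1 h.2.2 then 1 else 0
  col g i := code (fun u : BddNode N => (S.info u.1 u.2 u.2, fun h : BddPair N =>
    ∑ j, if S.info u.1 u.2 j = S.info h.1 h.2.1 h.2.2 then (1 : ℝ) else 0)) ⟨g, i⟩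

/-- The values of the vector channels. -/
def chan {r : ℕ} (g : BddGraph N) (Λ : Fin r → ℝ) (U : Matrix (Fin g.1) (Fin r) ℝ) (i : Fin g.1)
    (a : Fin r) : Chan N → ℝ :=
  Sum.elim (fun k => U i a * Λ a ^ (k : ℕ)) (fun h => ∑ j, S.mult h g i j * U j a)

/-- A positive power of Λ stands between U and Uᵀ, so a power of A appears. Without it one would get
U Uᵀ, which is only the projection to the range of A. -/
theorem sum_chan_mul_chan {r : ℕ} {g : BddGraph N} {Λ : Fin r → ℝ} {U : Matrix (Fin g.1) (Fin r) ℝ}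
    (h : IsReducedEigendecomposition (adjMat g) Λ U) (i j : Fin g.1) (ρ : Readout N) :
    ∑ a, S.chan g Λ U i a ρ.left * S.chan g Λ U j a ρ.right = S.read g i j ρ := by
  have key : ∀ (k : ℕ) (i j : Fin g.1),
      (adjMat g ^ (k + 1)) i j = ∑ a, U i a * (U j a * Λ a ^ (k + 1)) := by
    intro k i j
    rw [h.pow_succ, Matrix.mul_apply]
    refine Finset.sum_congr rfl fun a _ => ?_
    rw [Matrix.mul_diagonal, Matrix.transpose_apply]
    ring
  have key2 : ∀ (q : BddPair N) (k : ℕ) (i j : Fin g.1), (S.mult q g * adjMat g ^ (k + 1)) i j =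
      ∑ a, (∑ l, S.mult q g i l * U l a) * (U j a * Λ a ^ (k + 1)) := by
    intro q k i j
    simp only [Matrix.mul_apply, key, Finset.mul_sum, Finset.sum_mul]
    rw [Finset.sum_comm]
    simp only [mul_assoc]
  rcases ρ with k | ⟨q, k⟩ | ⟨q, k⟩
  · simp [Readout.left, Readout.right, chan, read, key]
  · simp [Readout.left, Readout.right, chan, read, key2]
  · simp only [Readout.left, Readout.right, chan, read, key2, Sum.elim_inl, Sum.elim_inr,
      Fin.val_succ]
    exact Finset.sum_congr rfl fun a _ => mul_comm _ _

/-- The scalar representations of a stage; `c` is the value of the constant channel. -/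
noncomputable def scalars (c : ℝ) (g : BddGraph N) (i : Fin g.1) (x : Fin (hidDim N)) : ℝ :=
  Sum.elim (fun b => cond b (S.col g i) c) 0 (slot N x)

/-- The point representations of a stage; `c` is the value of the constant channel. -/
noncomputable def pointRep {r : ℕ} (c : ℝ) (g : BddGraph N) (Λ : Fin r → ℝ)
    (U : Matrix (Fin g.1) (Fin r) ℝ) : PointRep g.1 r (hidDim N) where
  s := S.scalars c g
  v i := Matrix.of fun a x => Sum.elim 0 (Sum.elim (S.chan g Λ U i a) 0) (slot N x)

/-- The readouts, as a vector indexed by channels. -/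
noncomputable def readVec (g : BddGraph N) (i j : Fin g.1) (x : Fin (hidDim N)) : ℝ :=
  Sum.elim 0 (Sum.elim 0 (S.read g i j)) (slot N x)

end Stage

/-! ### Weight matrices and the construction of one layer -/

open Classical in
/-- The matrix that sends a family of vector channels to the family of channels `f ρ`. -/
noncomputable def selectMat (f : Readout N → Chan N) :
    Matrix (Fin (hidDim N)) (Fin (hidDim N)) ℝ :=
  Matrix.of fun x y => Sum.elim 0 (Sum.elim 0 fun ρ => if slot N y = .inr (.inl (f ρ)) then 1 else 0)
    (slot N x)

theorem sum_selectMat_mul {r : ℕ} (f : Readout N → Chan N) (S : Stage N) (c : ℝ)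
    (g : BddGraph N) (Λ : Fin r → ℝ) (U : Matrix (Fin g.1) (Fin r) ℝ) (i : Fin g.1)
    (x : Fin (hidDim N)) (a : Fin r) : ∑ y, selectMat f x y * (S.pointRep c g Λ U).v i a y =
      Sum.elim (fun _ => 0) (Sum.elim (fun _ => 0) fun ρ => S.chan g Λ U i a (f ρ)) (slot N x) := by
  classical
  simp only [selectMat, Stage.pointRep, Matrix.of_apply]
  rw [(slot N).sum_comp fun y => Sum.elim (0 : Bool → ℝ) (Sum.elim (0 : Chan N → ℝ) fun ρ =>
    if y = .inr (.inl (f ρ)) then (1 : ℝ) else 0) (slot N x) *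
      Sum.elim (0 : Bool → ℝ) (Sum.elim (S.chan g Λ U i a) (0 : Readout N → ℝ)) y]
  rcases slot N x with b | y | ρ <;> simp

theorem sum_selectMat_mul_selectMat {r : ℕ} (S : Stage N) (c : ℝ) {g : BddGraph N} {Λ : Fin r → ℝ}
    {U : Matrix (Fin g.1) (Fin r) ℝ} (h : IsReducedEigendecomposition (adjMat g) Λ U)
    (i j : Fin g.1) (x : Fin (hidDim N)) :
    ∑ y, (∑ a, (∑ z, selectMat Readout.left x z * (S.pointRep c g Λ U).v i a z) *
      (S.pointRep c g Λ U).v j a y) * selectMat Readout.right x y = S.readVec g i j x := by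
  have key : ∀ (F : Fin r → ℝ) (V : Fin r → Fin (hidDim N) → ℝ) (W : Fin (hidDim N) → ℝ),
      ∑ y, (∑ a, F a * V a y) * W y = ∑ a, F a * ∑ y, W y * V a y := by
    intro F V W
    simp only [Finset.sum_mul, Finset.mul_sum]
    rw [Finset.sum_comm]
    exact Finset.sum_congr rfl fun a _ => Finset.sum_congr rfl fun y _ => by ring
  refine (key (fun a => ∑ z, selectMat Readout.left x z * (S.pointRep c g Λ U).v i a z)
    (fun a y => (S.pointRep c g Λ U).v j a y) fun y => selectMat Readout.right x y).trans ?_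
  simp only [sum_selectMat_mul]
  rw [Stage.readVec]
  rcases slot N x with b | y | ρ
  · simp
  · simp
  · simpa using S.sum_chan_mul_chan h i j ρ

/-! The representations of a layer, with the matrix products written as sums. -/

theorem PSTLayer.mixS_eq {n r d : ℕ} (P : PSTLayer d) (x : PointRep n r d) (i : Fin n) :
    P.mixS x i = P.mlp₁.eval (Sum.elim (x.s i) fun c =>
      ∑ y, (∑ a, (∑ z, P.W₁ c z * x.v i a z) * x.v i a y) * P.W₂ c y) := rfl

theorem PSTLayer.atten_eq {n r d : ℕ} (P : PSTLayer d) (x : PointRep n r d) (i j : Fin n) :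
    P.atten x i j = P.mlp₃.eval (Sum.elim (fun c => (P.Wqs *ᵥ x.s i) c * (P.Wks *ᵥ x.s j) c)
      fun c => ∑ y, (∑ a, (∑ z, P.Wqv c z * x.v i a z) * x.v j a y) * P.Wkv y c) := rfl

theorem PSTLayer.apply_s {n r d : ℕ} (P : PSTLayer d) (x : PointRep n r d) (i : Fin n) :
    (P.apply x).s i = P.mlp₄.eval (Sum.elim (P.mixS x i) fun hc =>
      ∑ j, P.atten x i j hc.1 * P.mixS x j hc.2) := rfl

theorem PSTLayer.apply_v {n r d : ℕ} (P : PSTLayer d) (x : PointRep n r d) (i : Fin n) (a : Fin r)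
    (c : Fin d) : (P.apply x).v i a c = ∑ y, P.mixV x i a y * P.W₅ c (.inl y) +
      ∑ h, ∑ y, (∑ j, P.atten x i j h * P.mixV x j a y) * P.W₅ c (.inr (h, y)) := by
  have : (P.apply x).v i a c = ∑ y, Matrix.fromCols (P.mixV x i)
    (Matrix.of fun a hc => ∑ j, P.atten x i j hc.1 * P.mixV x j a hc.2) a y * P.W₅ c y := rfl
  rw [this, Fintype.sum_sum_type, Fintype.sum_prod_type]
  rfl

theorem PointRep.ext {n r d : ℕ} {x y : PointRep n r d} (hs : ∀ i, x.s i = y.s i)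
    (hv : ∀ i a c, x.v i a c = y.v i a c) : x = y := by
  rcases x with ⟨s, v⟩
  rcases y with ⟨s', v'⟩
  rw [PointRep.mk.injEq]
  exact ⟨funext hs, funext fun i => Matrix.ext (hv i)⟩

open Classical in
/-- The matrix that exchanges the constant channel and the colour. -/
noncomputable def swapMat (N : ℕ) : Matrix (Fin (hidDim N)) (Fin (hidDim N)) ℝ :=
  Matrix.of fun x y => Sum.elim (fun b => if slot N y = .inl (!b) then 1 else 0) 0 (slot N x)

/-- The attention multiplies only scalars of equal index. After the swap on one side, each node's
colour meets the constant of the other node, so both colours survive separately. -/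
theorem swapMat_mulVec (S : Stage N) (c : ℝ) (g : BddGraph N) (i : Fin g.1) (x : Fin (hidDim N)) :
    (swapMat N *ᵥ S.scalars c g i) x = Sum.elim (fun b => cond b c (S.col g i)) 0 (slot N x) := by
  classical
  simp only [Matrix.mulVec, dotProduct, swapMat, Stage.scalars, Matrix.of_apply]
  rw [(slot N).sum_comp fun y => Sum.elim (fun b => if y = .inl (!b) then (1 : ℝ) else 0)
    (0 : Chan N ⊕ Readout N → ℝ)     (slot N x) * Sum.elim (fun b => cond b (S.col g i) c) (0 : Chan N ⊕ Readout N → ℝ) y]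
  rcases slot N x with (b | b) | y <;> simp

/-- The products of scalars of two nodes, from which their colours can be read off. -/
noncomputable def Stage.colourVec (S : Stage N) (c : ℝ) (g : BddGraph N) (i j : Fin g.1)
    (x : Fin (hidDim N)) : ℝ :=
  (swapMat N *ᵥ S.scalars c g i) x * S.scalars c g j x

open Classical in
/-- The output matrix for the vector channels. -/
noncomputable def outMat (N : ℕ) : Matrix (Fin (hidDim N))
    (Fin (hidDim N) ⊕ (Fin (Fintype.card (BddPair N)) × Fin (hidDim N))) ℝ :=
  Matrix.of fun x => Sum.elim
    (fun y => Sum.elim 0 (Sum.elim (Sum.elim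
      (fun k => if slot N y = .inr (.inl (.inl k)) then 1 else 0) 0) 0) (slot N x))
    (fun hy => Sum.elim 0 (Sum.elim (Sum.elim 0 fun q =>
      if (Fintype.equivFin (BddPair N)).symm hy.1 = q ∧ slot N hy.2 = .inr (.inl (.inl 0))
        then 1 else 0) 0) (slot N x))

/-- Every stage of the universal transformer is followed by the next stage. -/
theorem Stage.exists_layer (S : Stage N) (c : ℝ) (hc : ∀ g i, c * S.col g i = S.col g i) :
    ∃ P : PSTLayer (hidDim N), ∀ (g : BddGraph N) (r : ℕ) (Λ : Fin r → ℝ)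
      (U : Matrix (Fin g.1) (Fin r) ℝ), IsReducedEigendecomposition (adjMat g) Λ U →
        P.apply (S.pointRep c g Λ U) = S.next.pointRep 1 g Λ U := by
  classical
  -- the colours and the readouts determine the information on a pair
  have hread : ∀ (g g' : BddGraph N) (i j : Fin g.1) (i' j' : Fin g'.1),
      S.readVec g i j = S.readVec g' i' j' → S.read g i j = S.read g' i' j' := by
    intro g g' i j i' j' e
    funext ρ
    simpa [Stage.readVec] using congrFun e ((slot N).symm (.inr (.inr ρ)))
  have hinfo : ∀ (g g' : BddGraph N) (i j : Fin g.1) (i' j' : Fin g'.1),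
      S.colourVec c g i j = S.colourVec c g' i' j' → S.readVec g i j = S.readVec g' i' j' →
      S.info g i j = S.info g' i' j' := by
    intro g g' i j i' j' e1 e2
    have h0 := congrFun e1 ((slot N).symm (.inl false))
    have h1 := congrFun e1 ((slot N).symm (.inl true))
    simp only [Stage.colourVec, swapMat_mulVec, Stage.scalars, Equiv.apply_symm_apply,
      Sum.elim_inl, cond_true, cond_false] at h0 h1
    rw [mul_comm, hc, mul_comm, hc] at h0
    rw [hc, hc] at h1
    rw [Stage.info, Stage.info, h0, h1, hread _ _ _ _ _ _ e2]
  -- The scalars after `mlp₁`: the colour encodes the information on the pair (i, i), and the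
  -- constant channel becomes 1.
  let mid : Stage N :=
    ⟨fun g i => code (fun u : BddNode N => S.info u.1 u.2 u.2) ⟨g, i⟩, S.mult⟩
  have hmid : ∀ (g g' : BddGraph N) (i : Fin g.1) (i' : Fin g'.1),
      mid.col g i = mid.col g' i' ↔ S.info g i i = S.info g' i' i' :=
    fun g g' i i' => code_eq_iff (fun u : BddNode N => S.info u.1 u.2 u.2) ⟨g, i⟩ ⟨g', i'⟩
  obtain ⟨m₁, hm₁⟩ := MLP.exists_eval_eq
    (fun u : BddNode N => Sum.elim (S.scalars c u.1 u.2) (S.readVec u.1 u.2 u.2))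
    (fun u => mid.scalars 1 u.1 u.2) (by
      rintro ⟨g, i⟩ ⟨g', i'⟩ e
      have e1 : S.scalars c g i = S.scalars c g' i' := funext fun x => congrFun e (.inl x)
      have e2 : S.readVec g i i = S.readVec g' i' i' := funext fun x => congrFun e (.inr x)
      have : mid.col g i = mid.col g' i' :=
        (hmid _ _ _ _).2 (hinfo _ _ _ _ _ _ (by unfold Stage.colourVec; simp only [e1]) e2)
      funext x
      simp only [Stage.scalars, this])
  obtain ⟨m₃, hm₃⟩ := MLP.exists_eval_eq
    (fun q : BddPair N => Sum.elim (S.colourVec c q.1 q.2.1 q.2.2) (S.readVec q.1 q.2.1 q.2.2))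
    (fun q (h : Fin (Fintype.card (BddPair N))) =>
      S.next.mult ((Fintype.equivFin _).symm h) q.1 q.2.1 q.2.2) (by
      rintro ⟨g, i, j⟩ ⟨g', i', j'⟩ e
      have := hinfo g g' i j i' j' (funext fun x => congrFun e (.inl x))
        (funext fun x => congrFun e (.inr x))
      funext h
      simp only [Stage.next, this])
  obtain ⟨m₄, hm₄⟩ := MLP.exists_eval_eq
    (fun u : BddNode N => Sum.elim (mid.scalars 1 u.1 u.2)
      fun hx : Fin (Fintype.card (BddPair N)) × Fin (hidDim N) =>
        ∑ j, S.next.mult ((Fintype.equivFin _).symm hx.1) u.1 u.2 j * mid.scalars 1 u.1 j hx.2)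
    (fun u => S.next.scalars 1 u.1 u.2) (by
      rintro ⟨g, i⟩ ⟨g', i'⟩ e
      have e1 := congrFun e (.inl ((slot N).symm (.inl true)))
      -- Aggregating the constant channel, now 1, yields the row sums of the heads.
      have e2 : ∀ h : BddPair N, ∑ j, S.next.mult h g i j = ∑ j, S.next.mult h g' i' j := by
        intro h
        simpa [Stage.scalars] using
          congrFun e (.inr (Fintype.equivFin _ h, (slot N).symm (.inl false)))
      simp only [Sum.elim_inl, Stage.scalars, Equiv.apply_symm_apply, cond_true, hmid] at e1
      have : S.next.col g i = S.next.col g' i' :=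
        (code_eq_iff _ _ _).2 (Prod.ext e1 (funext e2))
      funext x
      simp only [Stage.scalars, this])
  let P : PSTLayer (hidDim N) :=
    { heads := Fintype.card (BddPair N)
      mlp₁ := m₁
      W₁ := selectMat Readout.left
      W₂ := selectMat Readout.right
      mlp₂ := .output 0 0
      W₃ := 0
      W₄ := 1
      Wqs := swapMat N
      Wks := 1
      Wqv := selectMat Readout.left
      Wkv := (selectMat Readout.right)ᵀ
      mlp₃ := m₃
      mlp₄ := m₄
      W₅ := outMat N }
  refine ⟨P, fun g r Λ U hU => ?_⟩
  have hmixS : ∀ i, P.mixS (S.pointRep c g Λ U) i = mid.scalars 1 g i := by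
    intro i
    rw [PSTLayer.mixS_eq]
    simp only [P, sum_selectMat_mul_selectMat S c hU]
    exact hm₁ ⟨g, i⟩
  have hmixV : ∀ i, P.mixV (S.pointRep c g Λ U) i = (S.pointRep c g Λ U).v i := by
    intro i
    simp [PSTLayer.mixV, P]
  have hatten : ∀ i j h, P.atten (S.pointRep c g Λ U) i j h =
      S.next.mult ((Fintype.equivFin _).symm h) g i j := by
    intro i j h
    rw [PSTLayer.atten_eq]
    simp only [P, Matrix.transpose_apply, Matrix.one_mulVec, sum_selectMat_mul_selectMat S c hU]
    exact congrFun (hm₃ ⟨g, i, j⟩) h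
  refine PointRep.ext (fun i => ?_) fun i a x => ?_
  · rw [PSTLayer.apply_s]
    simp only [hmixS, hatten]
    exact hm₄ ⟨g, i⟩
  · rw [PSTLayer.apply_v]
    simp only [hmixV, hatten]
    simp only [P, outMat, Sum.elim_inl, Sum.elim_inr, Matrix.of_apply,
      Stage.pointRep]
    -- The power channels are copied. Channel `q` is overwritten by head `q` applied to the
    -- power-zero channel, which is U.
    rcases slot N x with b | (k | q) | ρ
    · simp
    · simp only [Sum.elim_inl, Sum.elim_inr, Pi.zero_apply, mul_zero, Finset.sum_const_zero,
        add_zero]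
      rw [(slot N).sum_comp fun y => Sum.elim (0 : Bool → ℝ)
        (Sum.elim (S.chan g Λ U i a) (0 : Readout N → ℝ)) y *
        (if y = .inr (.inl (.inl k)) then (1 : ℝ) else 0)]
      simp [Stage.chan]
    · simp only [Sum.elim_inl, Sum.elim_inr, Pi.zero_apply, mul_zero, Finset.sum_const_zero,
        zero_add]
      have : ∀ h : Fin (Fintype.card (BddPair N)), ∑ y, (∑ j,
          S.next.mult ((Fintype.equivFin (BddPair N)).symm h) g i j *
            Sum.elim (0 : Bool → ℝ) (Sum.elim (S.chan g Λ U j a) (0 : Readout N → ℝ)) (slot N y)) *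
          (if (Fintype.equivFin (BddPair N)).symm h = q ∧ slot N y = .inr (.inl (.inl 0))
            then (1 : ℝ) else 0) =
          if (Fintype.equivFin (BddPair N)).symm h = q then
            ∑ j, S.next.mult q g i j * U j a else 0 := by
        intro h
        rw [(slot N).sum_comp fun y => (∑ j,
          S.next.mult ((Fintype.equivFin (BddPair N)).symm h) g i j *
            Sum.elim (0 : Bool → ℝ) (Sum.elim (S.chan g Λ U j a) (0 : Readout N → ℝ)) y) *
          (if (Fintype.equivFin (BddPair N)).symm h = q ∧ y = .inr (.inl (.inl 0))
            then (1 : ℝ) else 0)]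
        by_cases hq : (Fintype.equivFin (BddPair N)).symm h = q
        · subst hq
          simp [Stage.chan]
        · simp [hq]
      simp only [this]
      rw [(Fintype.equivFin (BddPair N)).symm.sum_comp fun h =>
        if h = q then ∑ j, S.next.mult q g i j * U j a else 0]
      simp [Stage.chan]
    · simp

/-! ### The universal transformer -/

/-- The stage before the first layer. -/
def initialStage (N : ℕ) : Stage N := ⟨0, 0⟩

/-- The stage after `t` layers. -/
noncomputable def stage (N t : ℕ) : Stage N := Stage.next^[t] (initialStage N)

theorem stage_succ (N t : ℕ) : stage N (t + 1) = (stage N t).next :=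
  Function.iterate_succ_apply' _ _ _

/-- The powers of the eigenvalues, in the channels for them. -/
noncomputable def eigenPowers (N : ℕ) {r : ℕ} (Λ : Fin r → ℝ) (a : Fin r) (x : Fin (hidDim N)) :
    ℝ :=
  Sum.elim (fun _ => 0) (Sum.elim (Sum.elim (fun k : Fin 8 => Λ a ^ (k : ℕ)) fun _ => 0) fun _ => 0)
    (slot N x)

/-- The eigenvalue function of the universal transformer. -/
noncomputable def powerEigenvalueFunction (N : ℕ) : EigenvalueFunction (hidDim N) where
  toFun _ := eigenPowers N
  continuous r := by
    refine continuous_pi fun a => continuous_pi fun x => ?_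
    simp only [eigenPowers]
    rcases slot N x with b | (k | q) | ρ
    · exact continuous_const
    · exact (continuous_apply a).pow _
    · exact continuous_const
    · exact continuous_const
  equivariant r σ Λ := rfl

theorem psrd_powerEigenvalueFunction {r : ℕ} (g : BddGraph N) (Λ : Fin r → ℝ)
    (U : Matrix (Fin g.1) (Fin r) ℝ) (i : Fin g.1) :
    psrd (powerEigenvalueFunction N) Λ U i = ((initialStage N).pointRep 0 g Λ U).v i := by
  ext a x
  simp only [psrd, Matrix.mul_diagonal, powerEigenvalueFunction, eigenPowers, Stage.pointRep, Matrix.of_apply]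
  rcases slot N x with b | (k | q) | ρ <;> simp [Stage.chan, initialStage]

theorem exists_layers (N t : ℕ) : ∃ l : List (PSTLayer (hidDim N)), l.length = t ∧
    ∀ (g : BddGraph N) (r : ℕ) (Λ : Fin r → ℝ) (U : Matrix (Fin g.1) (Fin r) ℝ),
      IsReducedEigendecomposition (adjMat g) Λ U →
        l.foldl (fun x P => P.apply x) ((initialStage N).pointRep 0 g Λ U) =
          (stage N t).pointRep (if t = 0 then 0 else 1) g Λ U := by
  induction t with
  | zero => exact ⟨[], rfl, fun _ _ _ _ _ => by simp [stage]⟩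
  | succ t ih =>
    obtain ⟨l, hl, h⟩ := ih
    -- Before the first layer the embedding is zero, so the constant channel is 0; this is harmless
    -- because the colours are 0 as well.
    obtain ⟨P, hP⟩ := (stage N t).exists_layer (if t = 0 then 0 else 1) (by
      intro g i
      split_ifs with ht
      · subst ht
        simp [stage, initialStage]
      · rw [one_mul])
    refine ⟨l ++ [P], by simp [hl], fun g r Λ U hU => ?_⟩
    rw [List.foldl_append, h g r Λ U hU, List.foldl_cons, List.foldl_nil, hP g r Λ U hU, stage_succ]
    simp

/-- A transformer with `t` layers whose last scalar representations determine the colours of the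
stage after `t` layers. -/
theorem exists_universalPST (p N t : ℕ) : ∃ P : PST p (hidDim N), P.numLayers = t ∧
    ∀ (g : BddGraph N) (X : Matrix (Fin g.1) (Fin p) ℝ) (r : ℕ) (Λ : Fin r → ℝ)
      (U : Matrix (Fin g.1) (Fin r) ℝ), IsReducedEigendecomposition (adjMat g) Λ U →
        ∀ i, (P.rep Λ U X).s i ((slot N).symm (.inl true)) = (stage N t).col g i := by
  obtain ⟨l, hl, h⟩ := exists_layers N t
  refine ⟨⟨powerEigenvalueFunction N, 0, l⟩, hl, fun g X r Λ U hU i => ?_⟩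
  have h0 : PointRep.mk (fun i => (0 : Matrix (Fin (hidDim N)) (Fin p) ℝ) *ᵥ X i)
      (psrd (powerEigenvalueFunction N) Λ U) = (initialStage N).pointRep 0 g Λ U := by
    rw [Stage.pointRep, PointRep.mk.injEq]
    constructor
    · funext i x
      simp only [Matrix.zero_mulVec, Stage.scalars, initialStage]
      rcases slot N x with (b | b) | y <;> simp
    · funext i
      exact psrd_powerEigenvalueFunction g Λ U i
  rw [PST.rep]
  simp only [h0]
  rw [h g r Λ U hU]
  simp [Stage.pointRep, Stage.scalars]

/-! ### Functions that the stages determine -/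

/-- `F` is determined by what is known of a pair of nodes after `t` layers. -/
def PairDet (t : ℕ) (F : PairFun N) : Prop :=
  ∀ (g g' : BddGraph N) (i j : Fin g.1) (i' j' : Fin g'.1),
    (stage N t).info g i j = (stage N t).info g' i' j' → F g i j = F g' i' j'

/-- `u` is determined by the colours after `t` layers. -/
def NodeDet (t : ℕ) (u : NodeFun N) : Prop :=
  ∀ (g g' : BddGraph N) (i : Fin g.1) (i' : Fin g'.1),
    (stage N t).col g i = (stage N t).col g' i' → u g i = u g' i'

theorem NodeDet.const (t : ℕ) (c : ℝ) : NodeDet (N := N) t fun _ _ => c :=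
  fun _ _ _ _ _ => rfl

theorem NodeDet.mul {t : ℕ} {u u' : NodeFun N} (h : NodeDet t u) (h' : NodeDet t u') :
    NodeDet t fun g i => u g i * u' g i :=
  fun g g' i i' e => by simp only [h g g' i i' e, h' g g' i i' e]

theorem NodeDet.sub {t : ℕ} {u u' : NodeFun N} (h : NodeDet t u) (h' : NodeDet t u') :
    NodeDet t fun g i => u g i - u' g i :=
  fun g g' i i' e => by simp only [h g g' i i' e, h' g g' i i' e]

theorem NodeDet.sum {ι : Type*} {t : ℕ} (s : Finset ι) {u : ι → NodeFun N}
    (h : ∀ a ∈ s, NodeDet t (u a)) : NodeDet t fun g i => ∑ a ∈ s, u a g i :=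
  fun g g' i i' e => Finset.sum_congr rfl fun a ha => h a ha g g' i i' e

theorem PairDet.mul {t : ℕ} {F F' : PairFun N} (h : PairDet t F) (h' : PairDet t F') :
    PairDet t fun g i j => F g i j * F' g i j :=
  fun g g' i j i' j' e => by simp only [h g g' i j i' j' e, h' g g' i j i' j' e]

theorem NodeDet.pairDet {t : ℕ} {u : NodeFun N} (h : NodeDet t u) :
    PairDet t fun g i _ => u g i :=
  fun g g' i _ i' _ e => h g g' i i' (congrArg Prod.fst e)

theorem pairDet_pow (t k : ℕ) (h0 : 0 < k) (h7 : k ≤ 7) :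
    PairDet (N := N) t fun g => adjMat g ^ k := by
  intro g g' i j i' j' e
  have := congrFun (congrArg (fun x => x.2.2) e) (.inl ⟨k - 1, by omega⟩)
  simpa [Stage.info, Stage.read, Nat.sub_add_cancel (Nat.succ_le_of_lt h0)] using this

theorem PairDet.transpose {t : ℕ} {F : PairFun N} (h : PairDet t F) :
    PairDet t fun g => (F g)ᵀ := by
  intro g g' i j i' j' e
  refine h g g' j i j' i' ?_
  simp only [Stage.info, Prod.mk.injEq] at e ⊢
  refine ⟨e.2.1, e.1, funext fun ρ => ?_⟩
  rcases ρ with k | ⟨q, k⟩ | ⟨q, k⟩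
  · have hs : ∀ g : BddGraph N, (adjMat g ^ ((k : ℕ) + 1)).IsSymm := fun g => by
      rw [Matrix.IsSymm, Matrix.transpose_pow, (adjMat_isSymm g).eq]
    have := congrFun e.2.2 (.inl k)
    simpa only [Stage.read, (hs _).apply] using this
  · exact congrFun e.2.2 (.inr (.inr (q, k)))
  · exact congrFun e.2.2 (.inr (.inl (q, k)))

theorem sum_ite_div_card {T : Type*} [Fintype T] (P : T → Prop) [DecidablePred P] {a : T} (ha : P a)
    (x : ℝ) : ∑ q, (if P q then x / (Finset.univ.filter P).card else 0) = x := by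
  have hpos : ((Finset.univ.filter P).card : ℝ) ≠ 0 := by
    rw [Nat.cast_ne_zero]
    exact Finset.card_ne_zero_of_mem (a := a) (by simp [ha])
  rw [← Finset.sum_filter, Finset.sum_const, nsmul_eq_mul]
  field_simp

/-- A determined function is a linear combination of the attention heads of the next layer. -/
theorem PairDet.exists_eq_sum {t : ℕ} {F : PairFun N} (h : PairDet t F) :
    ∃ c : BddPair N → ℝ, ∀ g i j, F g i j = ∑ q, c q * (stage N (t + 1)).mult q g i j := by
  classical
  let inf : BddPair N → ℝ × ℝ × (Readout N → ℝ) := fun q => (stage N t).info q.1 q.2.1 q.2.2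
  -- There is one head for every pair, so a class is represented as often as it has elements; hence
  -- the division by its size.
  refine ⟨fun q => F q.1 q.2.1 q.2.2 / (Finset.univ.filter fun q' => inf q' = inf q).card,
    fun g i j => ?_⟩
  have hterm : ∀ q : BddPair N, F q.1 q.2.1 q.2.2 /
      (Finset.univ.filter fun q' => inf q' = inf q).card * (stage N (t + 1)).mult q g i j =
      if inf q = inf ⟨g, i, j⟩ then
        F g i j / (Finset.univ.filter fun q' => inf q' = inf ⟨g, i, j⟩).card else 0 := by
    intro q
    rw [stage_succ]
    simp only [Stage.next]
    by_cases hq : inf q = inf ⟨g, i, j⟩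
    · rw [if_pos hq, hq, if_pos hq.symm, mul_one, h _ _ _ _ _ _ hq]
    · rw [if_neg hq, if_neg (fun e => hq e.symm), mul_zero]
  simp only [hterm]
  convert (sum_ite_div_card (fun q => inf q = inf ⟨g, i, j⟩) rfl (F g i j)).symm

theorem info_eq_of_col_succ_eq {t : ℕ} {g g' : BddGraph N} {i : Fin g.1} {i' : Fin g'.1}
    (e : (stage N (t + 1)).col g i = (stage N (t + 1)).col g' i') :
    (stage N t).info g i i = (stage N t).info g' i' i' ∧
      ∀ q, ∑ j, (stage N (t + 1)).mult q g i j = ∑ j, (stage N (t + 1)).mult q g' i' j := by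
  rw [stage_succ] at e ⊢
  have := (code_eq_iff _ _ _).1 e
  exact ⟨congrArg Prod.fst this, fun q => congrFun (congrArg Prod.snd this) q⟩

/-- The next colour records the row sums of all heads, and `F` is a linear combination of heads. -/
theorem PairDet.sum {t : ℕ} {F : PairFun N} (h : PairDet t F) :
    NodeDet (t + 1) fun g i => ∑ j, F g i j := by
  obtain ⟨c, hc⟩ := h.exists_eq_sum
  intro g g' i i' e
  simp only [hc]
  rw [Finset.sum_comm, Finset.sum_comm (s := Finset.univ (α := Fin g'.1))]
  simp only [← Finset.mul_sum, (info_eq_of_col_succ_eq e).2]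

theorem PairDet.mul_pow {t : ℕ} {F : PairFun N} (h : PairDet t F) (k : ℕ) (h0 : 0 < k)
    (h7 : k ≤ 7) : PairDet (t + 1) fun g => F g * adjMat g ^ k := by
  obtain ⟨c, hc⟩ := h.exists_eq_sum
  have hF : ∀ (g : BddGraph N) (i j : Fin g.1), (F g * adjMat g ^ k) i j =
      ∑ q, c q * ((stage N (t + 1)).mult q g * adjMat g ^ k) i j := by
    intro g i j
    simp only [Matrix.mul_apply, hc, Finset.sum_mul, Finset.mul_sum]
    rw [Finset.sum_comm]
    simp only [mul_assoc]
  intro g g' i j i' j' e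
  refine (hF g i j).trans (Eq.trans ?_ (hF g' i' j').symm)
  refine Finset.sum_congr rfl fun q _ => ?_
  have := congrFun (congrArg (fun x => x.2.2) e) (.inr (.inl (q, ⟨k - 1, by omega⟩)))
  simp only [Stage.info, Stage.read, Nat.sub_add_cancel (Nat.succ_le_of_lt h0)] at this
  rw [this]

theorem NodeDet.succ {t : ℕ} {u : NodeFun N} (h : NodeDet t u) : NodeDet (t + 1) u :=
  fun g g' i i' e => h g g' i i' (congrArg Prod.fst (info_eq_of_col_succ_eq e).1)

/-- Not immediate, since a layer overwrites the channels M U. The old heads are functions of still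
older information, so by induction they remain determined, and `PairDet.mul_pow` recovers their
readouts. -/
theorem PairDet.succ {t : ℕ} {F : PairFun N} (h : PairDet t F) : PairDet (t + 1) F := by
  induction t generalizing F with
  | zero => exact go h fun q => by intro; intros; rfl
  | succ t ih =>
    refine go h fun q => ih ?_
    intro g g' i j i' j' e
    rw [stage_succ]
    simp only [Stage.next, e]
where
  go {t : ℕ} {F : PairFun N} (h : PairDet t F)
      (hm : ∀ q, PairDet t ((stage N t).mult q)) : PairDet (t + 1) F := by
    intro g g' i j i' j' e
    refine h g g' i j i' j' ?_
    have hcol : ∀ {i : Fin g.1} {i' : Fin g'.1},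
        (stage N (t + 1)).col g i = (stage N (t + 1)).col g' i' →
        (stage N t).col g i = (stage N t).col g' i' :=
      fun e => congrArg Prod.fst (info_eq_of_col_succ_eq e).1
    have he := e
    simp only [Stage.info, Prod.mk.injEq] at he ⊢
    refine ⟨hcol he.1, hcol he.2.1, funext fun ρ => ?_⟩
    rcases ρ with k | ⟨q, k⟩ | ⟨q, k⟩
    · exact congrFun he.2.2 (.inl k)
    · exact (hm q).mul_pow _ k.succ_pos k.2 g g' i j i' j' e
    · exact ((hm q).mul_pow _ k.succ_pos k.2).transpose g g' i j i' j' e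

theorem PairDet.mono {t t' : ℕ} (htt : t ≤ t') {F : PairFun N} (h : PairDet t F) :
    PairDet t' F := by
  induction htt with
  | refl => exact h
  | step _ ih => exact ih.succ

theorem NodeDet.mono {t t' : ℕ} (htt : t ≤ t') {u : NodeFun N} (h : NodeDet t u) :
    NodeDet t' u := by
  induction htt with
  | refl => exact h
  | step _ ih => exact ih.succ

open scoped Pointwise

/-! ### Elimination of variables from products over the edges of a pattern -/

/-- Kinds of factors at a pair of nodes: powers of the adjacency matrix, and functions that are
determined after `t` layers. -/
inductive EdgeKind where
  | power (k : ℕ)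
  | general (t : ℕ)

namespace EdgeKind

/-- A number of layers after which the factors of this kind are determined. -/
def level : EdgeKind → ℕ
  | power _ => 0
  | general t => t

/-- The kind of a product of two factors. -/
def mul : EdgeKind → EdgeKind → EdgeKind
  | power 1, power 1 => power 1
  | κ, κ' => general (max κ.level κ'.level)

/-- The kind of the product of a factor with an optional factor at one node. -/
def absorb : Option ℕ → EdgeKind → EdgeKind
  | none, κ => κ
  | some t, κ => general (max t κ.level)

/-- The kind of the matrix product with a power of the adjacency matrix. -/
def mulPower : EdgeKind → ℕ → Option EdgeKind
  | power k, k' => if k + k' ≤ 7 then some (power (k + k')) else none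
  | general t, _ => some (general (t + 1))

/-- The kind of the sum over a node with two neighbours. -/
def compose (un : Option ℕ) : EdgeKind → EdgeKind → Option EdgeKind
  | κ, power k => (absorb un κ).mulPower k
  | power k, κ => (absorb un κ).mulPower k
  | general _, general _ => none

/-- The factors of a kind. -/
def Den (N : ℕ) : EdgeKind → PairFun N → Prop
  | power k, F => 0 < k ∧ k ≤ 7 ∧ F = fun g => adjMat g ^ k
  | general t, F => PairDet t F

theorem Den.pairDet {κ : EdgeKind} {F : PairFun N} (h : κ.Den N F) : PairDet κ.level F := by
  rcases κ with k | t
  · obtain ⟨h0, h7, rfl⟩ := h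
    exact pairDet_pow _ k h0 h7
  · exact h

theorem Den.transpose {κ : EdgeKind} {F : PairFun N} (h : κ.Den N F) :
    κ.Den N fun g => (F g)ᵀ := by
  rcases κ with k | t
  · obtain ⟨h0, h7, rfl⟩ := h
    refine ⟨h0, h7, funext fun g => ?_⟩
    rw [Matrix.transpose_pow, (adjMat_isSymm g).eq]
  · exact PairDet.transpose h

theorem Den.mul {κ κ' : EdgeKind} {F F' : PairFun N} (h : κ.Den N F) (h' : κ'.Den N F') :
    (κ.mul κ').Den N fun g i j => F g i j * F' g i j := by
  have hgen : PairDet (max κ.level κ'.level) fun g i j => F g i j * F' g i j :=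
    (h.pairDet.mono (le_max_left _ _)).mul (h'.pairDet.mono (le_max_right _ _))
  unfold EdgeKind.mul
  split
  -- The entries of A are 0 or 1, so A is idempotent under the entrywise product.
  · obtain ⟨-, -, rfl⟩ := h
    obtain ⟨-, -, rfl⟩ := h'
    refine ⟨one_pos, by norm_num, ?_⟩
    funext g i j
    simp only [pow_one, adjMat, SimpleGraph.adjMatrix_apply]
    split_ifs <;> simp
  · exact hgen

/-- The factors at one node: none, or a function that is determined after `t` layers. -/
def NodeDen (N : ℕ) : Option ℕ → NodeFun N → Prop
  | none, u => u = fun _ _ => 1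
  | some t, u => NodeDet t u

theorem Den.absorb {un : Option ℕ} {κ : EdgeKind} {u : NodeFun N} {F : PairFun N}
    (hu : NodeDen N un u) (h : κ.Den N F) : (absorb un κ).Den N fun g i j => u g i * F g i j := by
  rcases un with - | t
  · obtain rfl := hu
    simpa only [EdgeKind.absorb, one_mul] using h
  · exact ((NodeDet.pairDet hu).mono (le_max_left _ _)).mul (h.pairDet.mono (le_max_right _ _))

theorem Den.mulPower {κ κ' : EdgeKind} {F : PairFun N} (h : κ.Den N F) {k : ℕ} (h0 : 0 < k)
    (h7 : k ≤ 7) (e : κ.mulPower k = some κ') : κ'.Den N fun g => (F g)ᵀ * adjMat g ^ k := by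
  rcases κ with m | t
  · obtain ⟨hm, -, rfl⟩ := h
    simp only [EdgeKind.mulPower] at e
    split_ifs at e with hle
    obtain rfl := Option.some.inj e
    refine ⟨by omega, hle, funext fun g => ?_⟩
    rw [Matrix.transpose_pow, (adjMat_isSymm g).eq, pow_add]
  · obtain rfl := Option.some.inj e
    exact PairDet.mul_pow (PairDet.transpose h) k h0 h7

/-- Heads are read only against power channels, so one of the two factors must be a power of A; the
node factor is absorbed into the other one. -/
theorem Den.compose {un : Option ℕ} {κ κ' κ'' : EdgeKind} {u : NodeFun N} {F F' : PairFun N}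
    (hu : NodeDen N un u) (h : κ.Den N F) (h' : κ'.Den N F') (e : compose un κ κ' = some κ'') :
    κ''.Den N fun g i j => ∑ x, u g x * (F g x i * F' g x j) := by
  have key : ∀ {κ : EdgeKind} {F : PairFun N} {k : ℕ} {F' : PairFun N}, κ.Den N F →
      (power k).Den N F' → (EdgeKind.absorb un κ).mulPower k = some κ'' →
      κ''.Den N fun g i j => ∑ x, u g x * (F g x i * F' g x j) := by
    intro κ F k F' h h' e
    obtain ⟨h0, h7, rfl⟩ := h'
    have := (h.absorb hu).mulPower h0 h7 e
    refine (congrArg (EdgeKind.Den N κ'') (funext fun g => Matrix.ext fun i j => ?_)).mp this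
    change ∑ x, u g x * F g x i * (adjMat g ^ k) x j = ∑ x, u g x * (F g x i * (adjMat g ^ k) x j)
    simp only [mul_assoc]
  rcases κ' with k' | t'
  · exact key h h' e
  · rcases κ with k | t
    · have := (key h' h e).transpose
      refine (congrArg (EdgeKind.Den N κ'') (funext fun g => Matrix.ext fun i j => ?_)).mp this
      change ∑ x, u g x * (F' g x j * F g x i) = ∑ x, u g x * (F g x i * F' g x j)
      simp only [mul_comm (F' g _ _)]
    · simp [EdgeKind.compose] at e

end EdgeKind

/-- Functions of the maps of a set of variables into the nodes. -/
abbrev PatFun (N : ℕ) (α : Type) : Type := ∀ g : BddGraph N, (α → Fin g.1) → ℝ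

/-- The factors of a product over a pattern. -/
inductive Factor (α : Type) where
  | node (a : α) (t : ℕ)
  | edge (a b : α) (κ : EdgeKind)

namespace Factor

variable {α : Type}

/-- The functions that a factor may stand for. -/
def Den (N : ℕ) : Factor α → Set (PatFun N α)
  | node a t => {Ψ | ∃ u : NodeFun N, NodeDet t u ∧ Ψ = fun g f => u g (f a)}
  | edge a b κ => {Ψ | ∃ F : PairFun N, κ.Den N F ∧ Ψ = fun g f => F g (f a) (f b)}

theorem den_edge_comm (a b : α) (κ : EdgeKind) : Den N (edge a b κ) ⊆ Den N (edge b a κ) := by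
  rintro _ ⟨F, hF, rfl⟩
  exact ⟨_, hF.transpose, rfl⟩

/-- The products that a list of factors may stand for. -/
def ListDen (N : ℕ) (l : List (Factor α)) : Set (PatFun N α) := (l.map (Den N)).prod

/-- The factor does not involve the variable. -/
def Avoids (v : α) : Factor α → Prop
  | node a _ => a ≠ v
  | edge a b _ => a ≠ v ∧ b ≠ v

variable [DecidableEq α]

theorem Avoids.update {v : α} {x : Factor α} (hx : x.Avoids v) {Ψ : PatFun N α} (h : Ψ ∈ Den N x)
    (g : BddGraph N) (f : α → Fin g.1) (y : Fin g.1) : Ψ g (Function.update f v y) = Ψ g f := by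
  rcases x with ⟨a, t⟩ | ⟨a, b, κ⟩
  · obtain ⟨u, -, rfl⟩ := h
    simp only [Function.update_of_ne hx]
  · obtain ⟨F, -, rfl⟩ := h
    simp only [Function.update_of_ne hx.1, Function.update_of_ne hx.2]

theorem update_of_forall_avoids {v : α} {l : List (Factor α)} (hl : ∀ x ∈ l, x.Avoids v)
    {Ψ : PatFun N α} (h : Ψ ∈ ListDen N l) (g : BddGraph N) (f : α → Fin g.1) (y : Fin g.1) :
    Ψ g (Function.update f v y) = Ψ g f := by
  induction l generalizing Ψ with
  | nil =>
    obtain rfl : Ψ = 1 := h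
    rfl
  | cons x l ih =>
    rw [ListDen, List.map_cons, List.prod_cons] at h
    obtain ⟨Ψ₁, h₁, Ψ₂, h₂, rfl⟩ := h
    simp only [Pi.mul_apply, (hl x List.mem_cons_self).update h₁,
      ih (fun x hx => hl x (List.mem_cons_of_mem _ hx)) h₂]

end Factor

section Elimination

variable {α : Type} [DecidableEq α]

/-- Add an edge to a list of edges at a node, which are given by their other ends. -/
def insertEdge (o : α) (κ : EdgeKind) : List (α × EdgeKind) → List (α × EdgeKind)
  | [] => [(o, κ)]
  | (o', κ') :: l => if o = o' then (o', κ.mul κ') :: l else (o', κ') :: insertEdge o κ l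

/-- A list of factors, split by a variable: the factors that do not involve it, the product of its
factors at nodes, and its edges. -/
structure Split (α : Type) where
  rest : List (Factor α)
  un : Option ℕ
  nb : List (α × EdgeKind)

namespace Split

/-- Add a factor. -/
def insert (v : α) (x : Factor α) (S : Split α) : Split α :=
  match x with
  | .node a t =>
    if a = v then ⟨S.rest, some (max t (S.un.getD 0)), S.nb⟩ else ⟨x :: S.rest, S.un, S.nb⟩
  | .edge a b κ =>
    if a = v then ⟨S.rest, S.un, insertEdge b κ S.nb⟩
    else if b = v then ⟨S.rest, S.un, insertEdge a κ S.nb⟩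
    else ⟨x :: S.rest, S.un, S.nb⟩

/-- Split a list of factors. -/
def ofList (v : α) (l : List (Factor α)) : Split α := l.foldr (insert v) ⟨[], none, []⟩

/-- The factors that remain after the summation over the variable. -/
def elim (v : α) : Split α → Option (List (Factor α))
  | ⟨rest, un, [(o, κ)]⟩ =>
    if o = v then none else some (.node o ((EdgeKind.absorb un κ).level + 1) :: rest)
  | ⟨rest, un, [(o, κ), (o', κ')]⟩ =>
    if o = v ∨ o' = v then none
    else (EdgeKind.compose un κ κ').map fun κ'' => .edge o o' κ'' :: rest
  | _ => none

/-- The functions that the edges at `v` may stand for. -/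
def nbDen (N : ℕ) (v : α) (nb : List (α × EdgeKind)) : Set (PatFun N α) :=
  (nb.map fun p => Factor.Den N (.edge v p.1 p.2)).prod

/-- The functions that the factors at the node `v` may stand for. -/
def unDen (N : ℕ) (v : α) (un : Option ℕ) : Set (PatFun N α) :=
  {Ψ | ∃ u : NodeFun N, EdgeKind.NodeDen N un u ∧ Ψ = fun g f => u g (f v)}

/-- The functions that a split list may stand for. -/
def Den (N : ℕ) (v : α) (S : Split α) : Set (PatFun N α) :=
  Factor.ListDen N S.rest * unDen N v S.un * nbDen N v S.nb

/-- Parallel edges are merged, so the length of the list is the number of distinct neighbours of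
`v`. -/
theorem mul_nbDen_subset (v o : α) (κ : EdgeKind) (nb : List (α × EdgeKind)) :
    Factor.Den N (.edge v o κ) * nbDen N v nb ⊆ nbDen N v (insertEdge o κ nb) := by
  induction nb with
  | nil => exact subset_rfl
  | cons p nb ih =>
    obtain ⟨o', κ'⟩ := p
    simp only [insertEdge]
    split_ifs with h
    · subst h
      simp only [nbDen, List.map_cons, List.prod_cons]
      rw [← mul_assoc]
      refine Set.mul_subset_mul_right ?_
      rintro _ ⟨_, ⟨F, hF, rfl⟩, _, ⟨F', hF', rfl⟩, rfl⟩
      exact ⟨_, hF.mul hF', rfl⟩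
    · simp only [nbDen, List.map_cons, List.prod_cons] at ih ⊢
      rw [mul_left_comm]
      exact Set.mul_subset_mul_left ih

theorem mul_unDen_subset {β : Type} (v : β) (t : ℕ) (un : Option ℕ) :
    Factor.Den N (.node v t) * unDen N v un ⊆ unDen N v (some (max t (un.getD 0))) := by
  rintro _ ⟨_, ⟨u, hu, rfl⟩, _, ⟨u', hu', rfl⟩, rfl⟩
  refine ⟨fun g i => u g i * u' g i, ?_, rfl⟩
  refine (hu.mono (le_max_left _ _)).mul ?_
  rcases un with - | t'
  · obtain rfl := hu'
    exact NodeDet.const _ 1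
  · exact NodeDet.mono (le_max_right _ _) hu'

theorem mul_den_subset (v : α) (x : Factor α) (S : Split α) :
    Factor.Den N x * S.Den N v ⊆ (S.insert v x).Den N v := by
  have hrest : Factor.Den N x * S.Den N v ⊆ (⟨x :: S.rest, S.un, S.nb⟩ : Split α).Den N v := by
    simp only [Den, Factor.ListDen, List.map_cons, List.prod_cons, mul_assoc]
    exact subset_rfl
  have hnb : ∀ {o : α} {κ : EdgeKind}, Factor.Den N x ⊆ Factor.Den N (.edge v o κ) →
      Factor.Den N x * S.Den N v ⊆ (⟨S.rest, S.un, insertEdge o κ S.nb⟩ : Split α).Den N v := by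
    intro o κ h
    simp only [Den]
    rw [mul_left_comm]
    exact Set.mul_subset_mul_left
      ((Set.mul_subset_mul_right h).trans (mul_nbDen_subset v o κ S.nb))
  rcases x with ⟨a, t⟩ | ⟨a, b, κ⟩
  · simp only [insert]
    split_ifs with h
    · subst h
      simp only [Den]
      rw [← mul_assoc, mul_left_comm]
      exact Set.mul_subset_mul_right (Set.mul_subset_mul_left (mul_unDen_subset a t S.un))
    · exact hrest
  · simp only [insert]
    split_ifs with h h'
    · subst h
      exact hnb subset_rfl
    · subst h'
      exact hnb (Factor.den_edge_comm _ _ _)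
    · exact hrest

theorem listDen_subset (v : α) (l : List (Factor α)) :
    Factor.ListDen N l ⊆ (ofList v l).Den N v := by
  induction l with
  | nil =>
    rintro _ rfl
    exact ⟨1, ⟨1, rfl, 1, ⟨fun _ _ => 1, rfl, rfl⟩, one_mul _⟩, 1, rfl, one_mul _⟩
  | cons x l ih =>
    rw [Factor.ListDen, List.map_cons, List.prod_cons]
    exact (Set.mul_subset_mul_left ih).trans (mul_den_subset v x _)

theorem avoids_of_mem_rest {v : α} {l : List (Factor α)} :
    ∀ x ∈ (ofList v l).rest, x.Avoids v := by
  induction l with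
  | nil => simp [ofList]
  | cons y l ih =>
    have hy : y.Avoids v → ∀ x ∈ y :: (ofList v l).rest, x.Avoids v := by
      intro hy x hx
      rcases List.mem_cons.1 hx with rfl | hx
      · exact hy
      · exact ih x hx
    change ∀ x ∈ (insert v y (ofList v l)).rest, x.Avoids v
    rcases y with ⟨a, t⟩ | ⟨a, b, κ⟩
    · simp only [insert]
      split_ifs with h
      · exact ih
      · exact hy h
    · simp only [insert]
      split_ifs with h h'
      · exact ih
      · exact ih
      · exact hy ⟨h, h'⟩

end Split

/-- The sum over all values of a variable. -/
def sumVar (v : α) (Ψ : PatFun N α) : PatFun N α :=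
  fun g f => ∑ y, Ψ g (Function.update f v y)

/-- Factors avoiding `v` come out of the sum. What is left is a column sum at the only neighbour, or
a matrix product between the two neighbours. -/
theorem sumVar_mem_of_elim_eq {v : α} {l l' : List (Factor α)}
    (h : (Split.ofList v l).elim v = some l') {Ψ : PatFun N α} (hΨ : Ψ ∈ Factor.ListDen N l) :
    sumVar v Ψ ∈ Factor.ListDen N l' := by
  have hrest := Split.avoids_of_mem_rest (v := v) (l := l)
  have hmem := Split.listDen_subset v l hΨ
  clear hΨ
  generalize Split.ofList v l = S at h hrest hmem
  obtain ⟨rest, un, nb⟩ := S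
  obtain ⟨_, ⟨R, hR, _, ⟨u, hu, rfl⟩, rfl⟩, B, hB, rfl⟩ := hmem
  have hR' := fun g f y => Factor.update_of_forall_avoids hrest hR g f y
  rcases nb with _ | ⟨⟨o, κ⟩, _ | ⟨⟨o', κ'⟩, _ | ⟨p, nb⟩⟩⟩
  · simp [Split.elim] at h
  · simp only [Split.elim] at h
    split_ifs at h with ho
    obtain rfl := Option.some.inj h
    simp only [Split.nbDen, List.map_cons, List.map_nil, List.prod_cons, List.prod_nil,
      mul_one] at hB
    obtain ⟨F, hF, rfl⟩ := hB
    rw [Factor.ListDen, List.map_cons, List.prod_cons]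
    refine ⟨_, ⟨_, (hF.absorb hu).pairDet.transpose.sum, rfl⟩, R, hR, ?_⟩
    funext g f
    simp only [Pi.mul_apply, sumVar, hR', Function.update_self, Function.update_of_ne ho,
      Finset.sum_mul]
    refine Finset.sum_congr rfl fun y _ => ?_
    change u g y * F g y (f o) * R g f = _
    ring
  · simp only [Split.elim] at h
    split_ifs at h with ho
    obtain ⟨κ'', hκ, rfl⟩ := Option.map_eq_some_iff.1 h
    simp only [Split.nbDen, List.map_cons, List.map_nil, List.prod_cons, List.prod_nil,
      mul_one] at hB
    obtain ⟨_, ⟨F, hF, rfl⟩, _, ⟨F', hF', rfl⟩, rfl⟩ := hB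
    rw [Factor.ListDen, List.map_cons, List.prod_cons]
    refine ⟨_, ⟨_, EdgeKind.Den.compose hu hF hF' hκ, rfl⟩, R, hR, ?_⟩
    funext g f
    simp only [Pi.mul_apply, sumVar, hR', Function.update_self,
      Function.update_of_ne (fun e => ho (.inl e)), Function.update_of_ne (fun e => ho (.inr e)),
      Finset.sum_mul]
    exact Finset.sum_congr rfl fun y _ => by ring
  · simp [Split.elim] at h

/-- The sum over all values of the variables in a list. -/
noncomputable def sumVars [Fintype α] (live : List α) (Ψ : PatFun N α) : PatFun N α :=
  fun g f => ∑ f' ∈ Finset.univ.filter (fun f' : α → Fin g.1 => ∀ a ∉ live, f' a = f a), Ψ g f'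

theorem sumVars_nil [Fintype α] (Ψ : PatFun N α) : sumVars [] Ψ = Ψ := by
  funext g f
  have : Finset.univ.filter (fun f' : α → Fin g.1 => ∀ a ∉ ([] : List α), f' a = f a) = {f} := by
    ext f'
    simp [funext_iff]
  rw [sumVars, this, Finset.sum_singleton]

theorem sumVars_eq_sumVars_erase [Fintype α] {live : List α} (hl : live.Nodup) {v : α}
    (hv : v ∈ live) (Ψ : PatFun N α) : sumVars live Ψ = sumVars (live.erase v) (sumVar v Ψ) := by
  funext g f
  simp only [sumVars, sumVar]
  rw [Finset.sum_sigma']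
  refine Finset.sum_bij' (fun f' _ => ⟨Function.update f' v (f v), f' v⟩)
    (fun p _ => Function.update p.1 v p.2) ?_ ?_ ?_ ?_ ?_
  · intro f' hf'
    simp only [Finset.mem_filter, Finset.mem_univ, true_and, Finset.mem_sigma, and_true] at hf' ⊢
    intro a ha
    rw [hl.mem_erase_iff] at ha
    by_cases hav : a = v
    · subst hav
      rw [Function.update_self]
    · rw [Function.update_of_ne hav]
      exact hf' a fun h => ha ⟨hav, h⟩
  · rintro ⟨f', y⟩ hf'
    simp only [Finset.mem_filter, Finset.mem_univ, true_and, Finset.mem_sigma, and_true] at hf' ⊢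
    intro a ha
    have hav : a ≠ v := fun h => ha (h ▸ hv)
    rw [Function.update_of_ne hav]
    exact hf' a fun h => ha (List.mem_of_mem_erase h)
  · intro f' _
    simp
  · rintro ⟨f', y⟩ hf'
    simp only [Finset.mem_filter, Finset.mem_univ, true_and, Finset.mem_sigma, and_true] at hf'
    have : f v = f' v := (hf' v fun h => (hl.mem_erase_iff.1 h).1 rfl).symm
    simp [this]
  · intro f' _
    simp

/-- Whether the variables of a list can be eliminated one by one, such that only factors at the root
remain and these are determined after `T` layers. -/
def solve (root : α) (T : ℕ) : ℕ → List α → List (Factor α) → Bool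
  | _, [], l => l.all fun x => match x with
    | .node a t => a = root ∧ t ≤ T
    | .edge .. => false
  | 0, _ :: _, _ => false
  | n + 1, w :: live, l => (w :: live).any fun v => match (Split.ofList v l).elim v with
    | none => false
    | some l' => solve root T n ((w :: live).erase v) l'

theorem nodeDet_of_solve [Fintype α] {root : α} {T n : ℕ} {live : List α} {l : List (Factor α)}
    (h : solve root T n live l = true) (hl : live.Nodup) {Ψ : PatFun N α}
    (hΨ : Ψ ∈ Factor.ListDen N l) : NodeDet T fun g i => sumVars live Ψ g fun _ => i := by
  induction n, live, l using solve.induct (α := α) generalizing Ψ with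
  | case1 n l =>
    rw [sumVars_nil]
    rw [solve, List.all_eq_true] at h
    clear hl
    induction l generalizing Ψ with
    | nil =>
      obtain rfl : Ψ = 1 := hΨ
      exact NodeDet.const T 1
    | cons x l ih =>
      rw [Factor.ListDen, List.map_cons, List.prod_cons] at hΨ
      obtain ⟨Ψ₁, h₁, Ψ₂, h₂, rfl⟩ := hΨ
      refine NodeDet.mul ?_ (ih (fun x hx => h x (List.mem_cons_of_mem _ hx)) h₂)
      have hx := h x List.mem_cons_self
      rcases x with ⟨a, t⟩ | ⟨a, b, κ⟩
      · obtain ⟨u, hu, rfl⟩ := h₁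
        simp only [decide_eq_true_eq] at hx
        exact hu.mono hx.2
      · simp at hx
  | case2 => simp [solve] at h
  | case3 l n w live ih =>
    rw [solve, List.any_eq_true] at h
    obtain ⟨v, hv, h⟩ := h
    split at h
    · simp at h
    · rename_i l' hl'
      rw [sumVars_eq_sumVars_erase hl hv]
      exact ih v l' h (hl.erase v) (sumVar_mem_of_elim_eq hl' hΨ)

end Elimination

/-! ### Closed walks with prescribed coincidences -/

section ClosedWalks

variable {L : ℕ} [NeZero L]

/-- Whether `f` is a closed walk of length `L`, as a real number. -/
noncomputable def walkWeight (L : ℕ) [NeZero L] : PatFun N (Fin L) :=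
  fun g f => ∏ a, adjMat g (f a) (f (a + 1))

/-- The classes of `r`, other than the class of `0`. -/
def liveVars (r : Fin L → Fin L) : List (Fin L) :=
  (List.finRange L).filter fun a => r a = a ∧ a ≠ 0

/-- The edges of a closed walk of length `L` whose nodes are identified by `r`. -/
def cyclePattern (r : Fin L → Fin L) : List (Factor (Fin L)) :=
  (List.finRange L).map fun a => .edge (r a) (r (a + 1)) (.power 1)

/-- Either there is no closed walk whose nodes are identified by `r`, or the elimination succeeds. -/
def checkPattern (T : ℕ) (r : Fin L → Fin L) : Bool :=
  (List.finRange L).any (fun a => r a = r (a + 1)) || solve 0 T L (liveVars r) (cyclePattern r)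

/-- Check all identifications of the nodes of a closed walk that extend a given initial segment. -/
def checkPatterns (L T : ℕ) [NeZero L] : List (Fin L) → List (Fin L) → Bool
  | [], l => checkPattern T fun a => l.getD a 0
  | k :: ks, l => (List.finRange L).all fun v => !(v = k ∨ v ∈ l) || checkPatterns L T ks (l ++ [v])

/-- A partition is coded by the map to least elements of classes. Read in order, each value is the
index itself or an earlier value, which is what the search branches over. -/
theorem checkPattern_of_checkPatterns {T : ℕ} {r : Fin L → Fin L}
    (hr : ∀ k, r k = k ∨ ∃ j < k, r k = r j) (ks pre : List (Fin L))
    (hks : pre ++ ks = List.finRange L) (h : checkPatterns L T ks (pre.map r) = true) :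
    checkPattern T r = true := by
  induction ks generalizing pre with
  | nil =>
    rw [List.append_nil] at hks
    subst hks
    rw [checkPatterns] at h
    convert h using 2
    funext a
    simp [List.getD]
  | cons k ks ih =>
    rw [checkPatterns, List.all_eq_true] at h
    have := h (r k) (List.mem_finRange _)
    have hmem : r k = k ∨ r k ∈ pre.map r := by
      refine (hr k).imp_right ?_
      rintro ⟨j, hj, e⟩
      refine List.mem_map.2 ⟨j, ?_, e.symm⟩
      have hsort := List.pairwise_lt_finRange L
      have hjm := List.mem_finRange j
      rw [← hks] at hsort hjm
      rcases List.mem_append.1 hjm with h | h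
      · exact h
      · rcases List.mem_cons.1 h with rfl | h
        · exact absurd hj (lt_irrefl _)
        · exact absurd hj (not_lt_of_gt
            ((List.pairwise_cons.1 (List.pairwise_append.1 hsort).2.1).1 j h))
    simp only [hmem, decide_true, Bool.not_true, Bool.false_or] at this
    exact ih (pre ++ [k]) (by simpa using hks) (by simpa using this)

theorem walkWeight_comp_mem (r : Fin L → Fin L) :
    (fun g f => walkWeight L g (f ∘ r) : PatFun N (Fin L)) ∈ Factor.ListDen N (cyclePattern r) := by
  have key : ∀ l : List (Fin L),
      (fun g f => (l.map fun a => adjMat g (f (r a)) (f (r (a + 1)))).prod : PatFun N (Fin L)) ∈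
        Factor.ListDen N (l.map fun a => .edge (r a) (r (a + 1)) (.power 1)) := by
    intro l
    induction l with
    | nil => rfl
    | cons a l ih =>
      refine ⟨fun g f => adjMat g (f (r a)) (f (r (a + 1))),
        ⟨fun g => adjMat g, ⟨one_pos, by norm_num, by simp⟩, rfl⟩, _, ih, ?_⟩
      funext g f
      simp
  have e : (fun g f => walkWeight L g (f ∘ r) : PatFun N (Fin L)) =
      fun g f => ((List.finRange L).map fun a => adjMat g (f (r a)) (f (r (a + 1)))).prod := by
    funext g f
    rw [← List.ofFn_eq_map, List.prod_ofFn]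
    rfl
  rw [e]
  exact key _

open Classical in
/-- The number of closed walks `f` from `i`, in which at least the nodes that `s` identifies
coincide. -/
noncomputable def walksAbove (s : Setoid (Fin L)) : NodeFun N := fun g i =>
  ∑ f ∈ Finset.univ.filter (fun f : Fin L → Fin g.1 => f 0 = i ∧ s ≤ Setoid.ker f), walkWeight L g f

open Classical in
/-- The number of closed walks `f` from `i`, in which exactly the nodes that `s` identifies
coincide. -/
noncomputable def walksExactly (s : Setoid (Fin L)) : NodeFun N := fun g i =>
  ∑ f ∈ Finset.univ.filter (fun f : Fin L → Fin g.1 => f 0 = i ∧ Setoid.ker f = s), walkWeight L g f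

/-- The least elements of the classes of a setoid. -/
theorem exists_representatives {m : ℕ} (s : Setoid (Fin m)) : ∃ r : Fin m → Fin m,
    (∀ a b, s a b ↔ r a = r b) ∧ (∀ a, r (r a) = r a) ∧ ∀ a, r a ≤ a := by
  classical
  let C : Fin m → Finset (Fin m) := fun a => Finset.univ.filter fun b => s b a
  have hC : ∀ a, (C a).Nonempty := fun a => ⟨a, by simp [C]⟩
  have hmem : ∀ a, s ((C a).min' (hC a)) a := fun a => by
    simpa [C] using (C a).min'_mem (hC a)
  have hcongr : ∀ a b, s a b → (C a).min' (hC a) = (C b).min' (hC b) := by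
    intro a b h
    have : C a = C b := by
      ext c
      simp only [C, Finset.mem_filter, Finset.mem_univ, true_and]
      exact ⟨fun h' => s.trans h' h, fun h' => s.trans h' (s.symm h)⟩
    simp only [this]
  refine ⟨fun a => (C a).min' (hC a), fun a b => ⟨hcongr a b, fun h => ?_⟩,
    fun a => hcongr _ _ (hmem a), fun a => (C a).min'_le a (by simp [C])⟩
  have h1 := s.symm (hmem a)
  simp only [h] at h1
  exact s.trans h1 (hmem b)

/-- A walk compatible with `s` amounts to free values at the representatives other than 0. The
remaining variables are frozen at the dummy value `i`, which precomposition with `r` ignores except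
at 0. -/
theorem walksAbove_eq_sumVars {s : Setoid (Fin L)} {r : Fin L → Fin L}
    (hs : ∀ a b, s a b ↔ r a = r b) (hrr : ∀ a, r (r a) = r a) (hle : ∀ a, r a ≤ a)
    (g : BddGraph N) (i : Fin g.1) : walksAbove s g i =
      sumVars (liveVars r) (fun g f => walkWeight L g (f ∘ r)) g fun _ => i := by
  classical
  have h0 : r 0 = 0 := le_antisymm (hle 0) (Fin.zero_le _)
  have hlive : ∀ a, a ∈ liveVars r ↔ r a = a ∧ a ≠ 0 := fun a => by simp [liveVars]
  have hker : ∀ f : Fin L → Fin g.1, s ≤ Setoid.ker f ↔ ∀ a, f (r a) = f a := by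
    intro f
    constructor
    · intro h a
      exact h ((hs _ _).2 (hrr a))
    · intro h a b hab
      change f a = f b
      rw [← h a, ← h b, (hs a b).1 hab]
  have hback : ∀ f : Fin L → Fin g.1, f 0 = i → (∀ a, f (r a) = f a) →
      ((fun a => if a ∈ liveVars r then f a else i) ∘ r : Fin L → Fin g.1) = f := by
    intro f hi hf
    funext a
    simp only [Function.comp_apply, hlive, hrr, true_and]
    split_ifs with h
    · exact hf a
    · rw [← hf a, not_not.1 h, hi]
  rw [walksAbove, sumVars]
  refine Finset.sum_bij' (fun f _ a => if a ∈ liveVars r then f a else i) (fun f _ => f ∘ r)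
    ?_ ?_ ?_ ?_ ?_
  · intro f _
    simp only [Finset.mem_filter, Finset.mem_univ, true_and]
    intro a ha
    rw [if_neg ha]
  · intro f hf
    simp only [Finset.mem_filter, Finset.mem_univ, true_and, hker] at hf ⊢
    refine ⟨?_, fun a => by simp only [Function.comp_apply, hrr]⟩
    rw [Function.comp_apply, h0]
    exact hf 0 (by simp [hlive])
  · intro f hf
    simp only [Finset.mem_filter, Finset.mem_univ, true_and, hker] at hf
    exact hback f hf.1 hf.2
  · intro f hf
    simp only [Finset.mem_filter, Finset.mem_univ, true_and] at hf
    funext a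
    split_ifs with ha
    · rw [Function.comp_apply, ((hlive a).1 ha).1]
    · exact (hf a ha).symm
  · intro f hf
    simp only [Finset.mem_filter, Finset.mem_univ, true_and, hker] at hf
    rw [hback f hf.1 hf.2]

theorem nodeDet_walksAbove {T : ℕ} (hL : checkPatterns L T (List.finRange L) [] = true)
    (s : Setoid (Fin L)) : NodeDet (N := N) T (walksAbove s) := by
  classical
  obtain ⟨r, hs, hrr, hle⟩ := exists_representatives s
  have hcheck : checkPattern T r = true := by
    refine checkPattern_of_checkPatterns (fun k => ?_) (List.finRange L) [] rfl hL
    rcases (hle k).eq_or_lt with h | h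
    · exact .inl h
    · exact .inr ⟨r k, h, (hrr k).symm⟩
  rw [checkPattern, Bool.or_eq_true] at hcheck
  rcases hcheck with h | h
  · rw [List.any_eq_true] at h
    obtain ⟨a, -, ha⟩ := h
    rw [decide_eq_true_eq] at ha
    -- Identifying two consecutive nodes would require a self-loop.
    have : walksAbove s = (fun _ _ => 0 : NodeFun N) := by
      funext g i
      refine Finset.sum_eq_zero fun f hf => ?_
      rw [Finset.mem_filter] at hf
      refine Finset.prod_eq_zero (Finset.mem_univ a) ?_
      have : f a = f (a + 1) := hf.2.2 ((hs _ _).2 ha)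
      rw [← this]
      simp [adjMat]
    rw [this]
    exact NodeDet.const _ _
  · have := nodeDet_of_solve h ((List.nodup_finRange L).filter _) (walkWeight_comp_mem (N := N) r)
    have e : walksAbove s = _ := funext fun g => funext fun i =>
      walksAbove_eq_sumVars (N := N) hs hrr hle g i
    rw [e]
    exact this

theorem nodeDet_walksExactly {T : ℕ} (hL : checkPatterns L T (List.finRange L) [] = true)
    (s : Setoid (Fin L)) : NodeDet (N := N) T (walksExactly s) := by
  classical
  have : Finite (Setoid (Fin L)) := Finite.of_injective
    (fun s : Setoid (Fin L) => (fun a b => s a b : Fin L → Fin L → Prop)) fun s s' h =>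
      Setoid.ext fun a b => iff_of_eq (congrFun (congrFun h a) b)
  cases nonempty_fintype (Setoid (Fin L))
  -- Möbius inversion from the coarsest partition downwards: `walksAbove s` is the sum of
  -- `walksExactly s'` over all `s' ≥ s`.
  induction s using WellFoundedGT.induction with
  | ind s ih =>
    have e : walksExactly s = fun g i => walksAbove s g i -
        ∑ s' ∈ Finset.univ.filter (fun s' => s < s'), (walksExactly s' : NodeFun N) g i := by
      funext g i
      rw [eq_sub_iff_add_eq]
      have hIci : Finset.univ.filter (fun s' => s ≤ s') =
          insert s (Finset.univ.filter fun s' => s < s') := by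
        ext s'
        simp only [Finset.mem_filter, Finset.mem_univ, true_and, Finset.mem_insert]
        rw [le_iff_lt_or_eq, or_comm, eq_comm]
      have hsum : walksAbove s g i =
          ∑ s' ∈ Finset.univ.filter (fun s' => s ≤ s'), (walksExactly s' : NodeFun N) g i := by
        simp only [walksExactly]
        rw [walksAbove, ← Finset.sum_fiberwise_of_maps_to (g := fun f => Setoid.ker f)
          (t := Finset.univ.filter fun s' => s ≤ s')]
        · refine Finset.sum_congr rfl fun s' hs' => ?_
          rw [Finset.filter_filter]
          refine Finset.sum_congr (Finset.filter_congr fun f _ => ?_) fun _ _ => rfl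
          simp only [Finset.mem_filter, Finset.mem_univ, true_and] at hs'
          constructor
          · rintro ⟨⟨h1, -⟩, h2⟩
            exact ⟨h1, h2⟩
          · rintro ⟨h1, rfl⟩
            exact ⟨⟨h1, hs'⟩, rfl⟩
        · intro f hf
          simp only [Finset.mem_filter, Finset.mem_univ, true_and] at hf ⊢
          exact hf.2
      rw [hsum, hIci, Finset.sum_insert (by simp)]
    rw [e]
    refine (nodeDet_walksAbove hL s).sub (NodeDet.sum _ fun s' hs' => ih s' ?_)
    simpa using hs'

end ClosedWalks

/-- Lengths up to 7 are favourable: a closed walk covering a graph with a K4 minor passes at least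
twice through each of four branch nodes of degree at least 3, so it has length at least 8. Without
such a minor some non-root variable always has at most two neighbours. The evaluation also confirms
the layer counts and that two general factors need never be composed. -/
theorem checkPatterns_three : checkPatterns 3 1 (List.finRange 3) [] = true := by decide +kernel

theorem checkPatterns_four : checkPatterns 4 3 (List.finRange 4) [] = true := by decide +kernel

theorem checkPatterns_five : checkPatterns 5 3 (List.finRange 5) [] = true := by decide +kernel

theorem checkPatterns_six : checkPatterns 6 5 (List.finRange 6) [] = true := by decide +kernel

theorem checkPatterns_seven : checkPatterns 7 5 (List.finRange 7) [] = true := by decide +kernel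

/-! ### Cycles and injective closed walks -/

section CycleCount

variable {V : Type} {G : SimpleGraph V} {L : ℕ} [NeZero L]

/-- The injective closed walks of length `L` from `u`. -/
def injWalks (G : SimpleGraph V) (L : ℕ) [NeZero L] (u : V) : Set (Fin L → V) :=
  {f | f 0 = u ∧ Function.Injective f ∧ ∀ a, G.Adj (f a) (f (a + 1))}

/-- The edges of a closed walk. -/
def walkEdges (f : Fin L → V) : Set (Sym2 V) := {e | ∃ a, e = s(f a, f (a + 1))}

theorem fin_one_add_one_ne_zero (hL : 3 ≤ L) : (1 + 1 : Fin L) ≠ 0 := by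
  intro h
  have := congrArg Fin.val h
  rw [Fin.val_add, Fin.val_one', Nat.mod_eq_of_lt (by omega : 1 < L),
    Nat.mod_eq_of_lt (by omega : 1 + 1 < L)] at this
  simp at this

theorem fin_ofNat_succ (k : ℕ) : Fin.ofNat L (k + 1) = Fin.ofNat L k + 1 := by
  ext
  simp [Fin.val_add, Fin.ofNat, Nat.add_mod]

theorem walkEdges_neg (f : Fin L → V) : walkEdges (fun a => f (-a)) = walkEdges f := by
  ext e
  constructor
  · rintro ⟨a, rfl⟩
    refine ⟨-(a + 1), ?_⟩
    rw [Sym2.eq_swap, neg_add, neg_add_cancel_right, ← neg_add]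
  · rintro ⟨a, rfl⟩
    refine ⟨-(a + 1), ?_⟩
    rw [Sym2.eq_swap, neg_add, neg_add_cancel_right]
    simp only [neg_neg, ← neg_add]

theorem neg_mem_injWalks {u : V} {f : Fin L → V} (hf : f ∈ injWalks G L u) :
    (fun a => f (-a)) ∈ injWalks G L u := by
  refine ⟨by simpa using hf.1, hf.2.1.comp neg_injective, fun a => ?_⟩
  have := (hf.2.2 (-(a + 1))).symm
  rwa [neg_add, neg_add_cancel_right, ← neg_add] at this

theorem neg_ne_of_mem_injWalks (hL : 3 ≤ L) {u : V} {f : Fin L → V} (hf : f ∈ injWalks G L u) :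
    (fun a => f (-a)) ≠ f := by
  intro h
  have := hf.2.1 (congrFun h 1)
  exact fin_one_add_one_ne_zero hL (by rw [← neg_eq_iff_add_eq_zero, this])

/-- At each node of `f` only two of its edges are available, and injectivity of `h` forbids going
back, so the first step forces all others. -/
theorem eq_of_walkEdges_eq (hL : 3 ≤ L) {u : V} {f h : Fin L → V} (hf : f ∈ injWalks G L u)
    (hh : h ∈ injWalks G L u) (he : walkEdges h = walkEdges f) (h1 : h 1 = f 1) : h = f := by
  have key : ∀ k : ℕ, h (Fin.ofNat L k) = f (Fin.ofNat L k) ∧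
      h (Fin.ofNat L (k + 1)) = f (Fin.ofNat L (k + 1)) := by
    intro k
    induction k with
    | zero =>
      have e0 : Fin.ofNat L 0 = 0 := rfl
      have e1 : Fin.ofNat L 1 = 1 := by rw [fin_ofNat_succ, e0, zero_add]
      exact ⟨by rw [e0, hh.1, hf.1], by rw [zero_add, e1, h1]⟩
    | succ k ih =>
      refine ⟨ih.2, ?_⟩
      have hmem : s(h (Fin.ofNat L (k + 1)), h (Fin.ofNat L (k + 1) + 1)) ∈ walkEdges f :=
        he ▸ ⟨_, rfl⟩
      obtain ⟨a, ha⟩ := hmem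
      rw [fin_ofNat_succ (k + 1)]
      rcases Sym2.eq_iff.1 ha with ⟨e1, e2⟩ | ⟨e1, e2⟩
      · rw [ih.2] at e1
        rw [e2, ← hf.2.1 e1]
      · rw [ih.2, fin_ofNat_succ k] at e1
        have hak : Fin.ofNat L k = a := add_right_cancel (hf.2.1 e1)
        rw [← hak, ← ih.1] at e2
        have := hh.2.1 e2
        rw [fin_ofNat_succ, add_assoc] at this
        exact absurd (left_eq_add.1 this.symm) (fin_one_add_one_ne_zero hL)
  funext a
  have : Fin.ofNat L a = a := Fin.ext (Nat.mod_eq_of_lt a.2)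
  rw [← this]
  exact (key a).1

theorem eq_or_eq_neg_of_walkEdges_eq (hL : 3 ≤ L) {u : V} {f h : Fin L → V}
    (hf : f ∈ injWalks G L u) (hh : h ∈ injWalks G L u) (he : walkEdges h = walkEdges f) :
    h = f ∨ h = fun a => f (-a) := by
  have hmem : s(h 0, h (0 + 1)) ∈ walkEdges f := he ▸ ⟨_, rfl⟩
  obtain ⟨a, ha⟩ := hmem
  rw [zero_add, hh.1, ← hf.1] at ha
  rcases Sym2.eq_iff.1 ha with ⟨e1, e2⟩ | ⟨e1, e2⟩
  · rw [← hf.2.1 e1, zero_add] at e2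
    exact .inl (eq_of_walkEdges_eq hL hf hh he e2)
  · have : a = -1 := eq_neg_of_add_eq_zero_left (hf.2.1 e1).symm
    rw [this] at e2
    exact .inr (eq_of_walkEdges_eq hL (neg_mem_injWalks hf) hh (he.trans (walkEdges_neg f).symm) e2)

/-- Each edge set comes from exactly two walks, a walk and its reversal. -/
theorem ncard_injWalks [Finite V] (hL : 3 ≤ L) (u : V) :
    (injWalks G L u).ncard = 2 * (walkEdges '' injWalks G L u).ncard := by
  classical
  cases nonempty_fintype V
  have hfin := (injWalks G L u).toFinite
  rw [Set.ncard_eq_toFinset_card _ hfin, Set.ncard_eq_toFinset_card _ (hfin.image _),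
    Set.Finite.toFinset_image _ hfin, mul_comm, Finset.card_eq_sum_card_image walkEdges]
  refine Finset.sum_const_nat fun E hE => ?_
  obtain ⟨f, hf, rfl⟩ := Finset.mem_image.1 hE
  rw [Set.Finite.mem_toFinset] at hf
  have : hfin.toFinset.filter (fun h => walkEdges h = walkEdges f) = {f, fun a => f (-a)} := by
    ext h
    simp only [Finset.mem_filter, Set.Finite.mem_toFinset, Finset.mem_insert,
      Finset.mem_singleton]
    constructor
    · rintro ⟨hh, he⟩
      exact eq_or_eq_neg_of_walkEdges_eq hL hf hh he
    · rintro (rfl | rfl)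
      · exact ⟨hf, rfl⟩
      · exact ⟨neg_mem_injWalks hf, walkEdges_neg f⟩
  rw [this, Finset.card_pair (neg_ne_of_mem_injWalks hL hf).symm]

/-- The walk along a sequence of nodes. -/
def walkOfSeq (x : ℕ → V) (h : ∀ k, G.Adj (x k) (x (k + 1))) : (n : ℕ) → G.Walk (x 0) (x n)
  | 0 => .nil
  | n + 1 => (walkOfSeq x h n).concat (h n)

theorem support_walkOfSeq (x : ℕ → V) (h : ∀ k, G.Adj (x k) (x (k + 1))) (n : ℕ) :
    (walkOfSeq x h n).support = (List.range (n + 1)).map x := by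
  induction n with
  | zero => rfl
  | succ n ih =>
    rw [walkOfSeq, SimpleGraph.Walk.support_concat, ih, List.range_succ (n := n + 1)]
    simp

theorem edges_walkOfSeq (x : ℕ → V) (h : ∀ k, G.Adj (x k) (x (k + 1))) (n : ℕ) :
    (walkOfSeq x h n).edges = (List.range n).map fun k => s(x k, x (k + 1)) := by
  induction n with
  | zero => rfl
  | succ n ih =>
    rw [walkOfSeq, SimpleGraph.Walk.edges_concat, ih, List.range_succ]
    simp

theorem exists_isCycle_of_mem_injWalks (hL : 3 ≤ L) {u : V} {f : Fin L → V}
    (hf : f ∈ injWalks G L u) : ∃ c : G.Walk u u, c.IsCycle ∧ c.length = L ∧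
      walkEdges f = {e | e ∈ c.edges} := by
  obtain ⟨rfl, hinj, hadj⟩ := hf
  let x : ℕ → V := fun k => f (Fin.ofNat L k)
  have hx1 : ∀ k, x (k + 1) = f (Fin.ofNat L k + 1) := fun k => by
    simp only [x, fin_ofNat_succ]
  have hx : ∀ k, G.Adj (x k) (x (k + 1)) := fun k => by
    rw [hx1]
    exact hadj _
  have h0 : x 0 = f 0 := rfl
  have hL0 : x L = f 0 := by
    have : Fin.ofNat L L = 0 := Fin.ext (by simp [Fin.ofNat])
    simp only [x, this]
  have hofNat : ∀ {j k : ℕ}, j < L → k < L → Fin.ofNat L j = Fin.ofNat L k → j = k := by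
    intro j k hj hk e
    have := congrArg Fin.val e
    simpa [Fin.ofNat, Nat.mod_eq_of_lt hj, Nat.mod_eq_of_lt hk] using this
  let c : G.Walk (f 0) (f 0) := (walkOfSeq x hx L).copy h0 hL0
  have hedges : c.edges = (List.range L).map fun k => s(x k, x (k + 1)) := by
    rw [SimpleGraph.Walk.edges_copy, edges_walkOfSeq]
  have hlen : c.length = L := by
    rw [← SimpleGraph.Walk.length_edges, hedges, List.length_map, List.length_range]
  refine ⟨c, ?_, hlen, ?_⟩
  · rw [SimpleGraph.Walk.isCycle_def, SimpleGraph.Walk.isTrail_def]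
    refine ⟨?_, ?_, ?_⟩
    · rw [hedges]
      refine List.Nodup.map_on ?_ List.nodup_range
      intro j hj k hk e
      rw [List.mem_range] at hj hk
      rw [hx1, hx1] at e
      rcases Sym2.eq_iff.1 e with ⟨e1, -⟩ | ⟨e1, e2⟩
      · exact hofNat hj hk (hinj e1)
      · have h1 := hinj e1
        have h2 := hinj e2
        rw [h1, add_assoc] at h2
        exact absurd (add_eq_left.1 h2) (fin_one_add_one_ne_zero hL)
    · intro h
      have := congrArg SimpleGraph.Walk.length h
      rw [hlen, SimpleGraph.Walk.length_nil] at this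
      omega
    · rw [SimpleGraph.Walk.support_copy, support_walkOfSeq, List.range_succ_eq_map, List.map_cons,
        List.tail_cons, List.map_map]
      refine List.Nodup.map_on ?_ List.nodup_range
      intro j hj k hk e
      rw [List.mem_range] at hj hk
      simp only [Function.comp_apply, Nat.succ_eq_add_one, hx1] at e
      exact hofNat hj hk (add_right_cancel (hinj e))
  · ext e
    rw [Set.mem_ofPred_eq, hedges, List.mem_map]
    constructor
    · rintro ⟨a, rfl⟩
      refine ⟨a, List.mem_range.2 a.2, ?_⟩
      have : Fin.ofNat L a = a := Fin.ext (Nat.mod_eq_of_lt a.2)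
      rw [hx1]
      simp only [x, this]
    · rintro ⟨k, -, rfl⟩
      exact ⟨Fin.ofNat L k, by rw [hx1]⟩

theorem exists_mem_injWalks_of_isCycle {u : V} {c : G.Walk u u} (hc : c.IsCycle)
    (hlen : c.length = L) : ∃ f ∈ injWalks G L u, walkEdges f = {e | e ∈ c.edges} := by
  let f : Fin L → V := fun a => c.getVert a
  have hf1 : ∀ a : Fin L, f (a + 1) = c.getVert (a + 1) := by
    intro a
    simp only [f]
    rcases Nat.lt_or_ge (a + 1 : ℕ) L with h | h
    · congr 1
      rw [Fin.val_add, Fin.val_one', Nat.add_mod_mod, Nat.mod_eq_of_lt h]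
    -- Wrap-around: `a + 1` is 0 in `Fin L`, and the vertex at position `L` is the starting point
    -- again.
    · have ha : (a : ℕ) + 1 = L := le_antisymm a.2 h
      have : ((a + 1 : Fin L) : ℕ) = 0 := by
        rw [Fin.val_add, Fin.val_one', Nat.add_mod_mod, ha, Nat.mod_self]
      rw [this, ha, ← hlen, c.getVert_length, c.getVert_zero]
  refine ⟨f, ⟨c.getVert_zero, ?_, fun a => ?_⟩, ?_⟩
  · intro a b h
    refine Fin.ext (hc.getVert_injOn' ?_ ?_ h)
    · simp only [Set.mem_ofPred_eq]
      omega
    · simp only [Set.mem_ofPred_eq]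
      omega
  · rw [hf1]
    exact c.adj_getVert_succ (by rw [hlen]; exact a.2)
  · ext e
    induction e with
    | h v w =>
      rw [Set.mem_ofPred_eq, SimpleGraph.Walk.mk_mem_edges_iff_exists]
      constructor
      · rintro ⟨a, e⟩
        exact ⟨a, by rw [hlen]; exact a.2, by rw [e, hf1]⟩
      · rintro ⟨k, hk, e⟩
        refine ⟨⟨k, hlen ▸ hk⟩, ?_⟩
        rw [hf1]
        exact e.symm

/-- A cycle through `u` can be rotated to start at `u` without changing its edges. -/
theorem cycleCount_eq (hL : 3 ≤ L) (u : V) :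
    cycleCount G L u = (walkEdges '' injWalks G L u).ncard := by
  classical
  rw [cycleCount]
  congr 1
  ext E
  constructor
  · rintro ⟨w, c, hc, hlen, hu, rfl⟩
    obtain ⟨f, hf, he⟩ := exists_mem_injWalks_of_isCycle (hc.rotate hu)
      ((c.length_rotate u hu).trans hlen)
    refine ⟨f, hf, he.trans ?_⟩
    ext e
    exact (c.rotate_edges u hu).mem_iff
  · rintro ⟨f, hf, rfl⟩
    obtain ⟨c, hc, hlen, he⟩ := exists_isCycle_of_mem_injWalks hL hf
    exact ⟨u, c, hc, hlen, c.start_mem_support, he⟩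

end CycleCount

/-! ### From determined walk counts to cycle counts -/

theorem walksExactly_bot {L : ℕ} [NeZero L] (hL : 3 ≤ L) (g : BddGraph N) (i : Fin g.1) :
    walksExactly (⊥ : Setoid (Fin L)) g i = 2 * cycleCount g.2 L i := by
  classical
  have h : ∀ f : Fin L → Fin g.1, walkWeight L g f =
      if ∀ a, g.2.Adj (f a) (f (a + 1)) then 1 else 0 := by
    intro f
    simp only [walkWeight, adjMat, SimpleGraph.adjMatrix_apply]
    rw [Finset.prod_ite_zero]
    simp
  have hset : injWalks g.2 L i = ↑(Finset.univ.filter fun f : Fin L → Fin g.1 =>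
      (f 0 = i ∧ Setoid.ker f = ⊥) ∧ ∀ a, g.2.Adj (f a) (f (a + 1))) := by
    ext f
    simp [injWalks, and_assoc]
  have hcard := ncard_injWalks (G := g.2) hL i
  rw [← cycleCount_eq hL, hset, Set.ncard_coe_finset] at hcard
  simp only [walksExactly, h]
  rw [← Finset.sum_filter, Finset.filter_filter, Finset.sum_const, nsmul_eq_mul, mul_one]
  exact_mod_cast hcard

/-- A transformer that determines the colours after `t` layers counts the cycles of every length for
which the elimination succeeds. -/
theorem PST.countsCycles_of_checkPatterns {p t L : ℕ} [NeZero L] (hL : 3 ≤ L)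
    (hcheck : checkPatterns L t (List.finRange L) [] = true) {P : PST p (hidDim N)}
    (hP : ∀ (g : BddGraph N) (X : Matrix (Fin g.1) (Fin p) ℝ) (r : ℕ) (Λ : Fin r → ℝ)
      (U : Matrix (Fin g.1) (Fin r) ℝ), IsReducedEigendecomposition (adjMat g) Λ U →
        ∀ i, (P.rep Λ U X).s i ((slot N).symm (.inl true)) = (stage N t).col g i) :
    P.CountsCycles N L := by
  classical
  have hdet : ∀ u u' : BddNode N, (stage N t).col u.1 u.2 = (stage N t).col u'.1 u'.2 →
      (cycleCount u.1.2 L u.2 : ℝ) = cycleCount u'.1.2 L u'.2 := by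
    intro u u' e
    have := nodeDet_walksExactly hcheck ⊥ u.1 u'.1 u.2 u'.2 e
    rw [walksExactly_bot hL, walksExactly_bot hL] at this
    linarith
  -- The decoding map is prescribed on the finitely many colours that occur and is 0 elsewhere.
  refine ⟨fun s => Function.extend (fun u : BddNode N => (stage N t).col u.1 u.2)
    (fun u => (cycleCount u.1.2 L u.2 : ℝ)) 0 (s ((slot N).symm (.inl true))), ?_⟩
  intro n hn G _ X r Λ U hU i
  let u : BddNode N := ⟨⟨⟨n, Nat.lt_succ_of_le hn⟩, G⟩, i⟩
  have hU' : IsReducedEigendecomposition (adjMat u.1) Λ U := by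
    convert hU
    unfold adjMat
    congr
  have h := hP u.1 X r Λ U hU' i
  refine (congrArg _ h).trans ?_
  exact Function.FactorsThrough.extend_apply (fun u u' e => hdet u u' e) 0 u

theorem theorem7 (p N : ℕ) :
    (∃ (d : ℕ) (P : PST p d), P.numLayers = 1 ∧ P.CountsCycles N 3) ∧
    (∃ (d : ℕ) (P : PST p d), P.numLayers = 3 ∧ P.CountsCycles N 4 ∧ P.CountsCycles N 5) ∧
    (∃ (d : ℕ) (P : PST p d), P.numLayers = 5 ∧ P.CountsCycles N 6 ∧ P.CountsCycles N 7) := by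
  refine ⟨?_, ?_, ?_⟩
  · obtain ⟨P, hn, hP⟩ := exists_universalPST p N 1
    exact ⟨_, P, hn, PST.countsCycles_of_checkPatterns (by norm_num) checkPatterns_three hP⟩
  · obtain ⟨P, hn, hP⟩ := exists_universalPST p N 3
    exact ⟨_, P, hn, PST.countsCycles_of_checkPatterns (by norm_num) checkPatterns_four hP,
      PST.countsCycles_of_checkPatterns (by norm_num) checkPatterns_five hP⟩
  · obtain ⟨P, hn, hP⟩ := exists_universalPST p N 5
    exact ⟨_, P, hn, PST.countsCycles_of_checkPatterns (by norm_num) checkPatterns_six hP,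
      PST.countsCycles_of_checkPatterns (by norm_num) checkPatterns_seven hP⟩
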